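/- **Setting.** For a bounded measurable $f:[-\pi,\pi]\to\mathbb R$ let $T_f$ be the Laurent operator on $\ell^2(\mathbb Z)$, $(T_fx)_n=\sum_{m}a_{m-n}x_m$ with $a_n=\frac1{2\pi}\int_{-\pi}^{\pi}f(k)e^{-ikn}\,dk$. Let $V_\omega=\sum_n\omega_n|\delta_n\rangle\langle\delta_n|$, where $\omega=(\omega_n)_{n\in\mathbb Z}$ are i.i.d. with law $P_0$, a Borel probability measure on $\mathbb R$ that is not a point mass and satisfies $\inf\operatorname{supp}P_0=0$. For $K\in\mathbb N$ put $\Lambda_K=[-K,K]\cap\mathbb Z$ and let $n_K(E)=\frac{1}{2K+1}\operatorname{Tr}1_{(-\infty,E]}\big(1_{\Lambda_K}(T_f+V_\omega)1_{\Lambda_K}\big)$ be the normalized number of eigenvalues that are at most $E$, with multiplicity, of the restriction to $\ell^2(\Lambda_K)$. The integrated density of states (IDS) $N_f$ is the (unique, deterministic) non-decreasing right-continuous function such that almost surely $n_K(E)\to N_f(E)$ as $K\to\infty$ at every continuity point $E$ of $N_f$. Let $E_1,\dots,E_M\in\mathbb R/2\pi\mathbb Z$ be distinct, $\alpha>0$,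 $\mathfrak c>0$, $\overline\alpha=\min\{n\in\mathbb N:\alpha\le n\}$, $\beta=\alpha/\overline\alpha\le 1$, $N=M\overline\alpha$, and $$g(x)=\prod_{i=1}^M\big(2-2\cos(x-E_i)\big)^{\overline\alpha},\qquad f(x)=\mathfrak c\prod_{i=1}^M\big(2-2\cos(x-E_i)\big)^{\alpha}=\mathfrak c\,g(x)^\beta .$$ **Boundary conditions.** Write $\prod_{i=1}^M(z-e^{iE_i})^{\overline\alpha}=\sum_{k=0}^Np_kz^k$, and $p_k=0$ for $k>N$. The modified Dirichlet and Neumann boundary conditions are given by the $N\times N$ matrices $$(B_{\mathcal D})_{jl}=\sum_{m=1}^{N}\overline{p_{j+m}}\,p_{l+m}\quad(0\le j,l\le N-1),\qquad B_{\mathcal N}=-B_{\mathcal D}.$$ For $\star\in\{\mathcal D,\mathcal N\}$ and $\Lambda=\Lambda_L$ let $T^{\star,\star}_{g,\Lambda}=1_\Lambda T_g1_\Lambda+\operatorname{diag}(B_\star,0,\widetilde B_\star)$ on $\ell^2(\Lambda)$, where $\widetilde B_\star$ is the reflection of $B_\star$ along the anti-diagonal, $(\widetilde B_\star)_{jl}=(B_\star)_{N-1-l,\,N-1-j}$.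 **Statement.** The IDS $N_f$ exists, and for all $L\ge 2N+1$, with $\Lambda=\Lambda_L$, $|\Lambda|=2L+1$, and all $E\in\mathbb R$, $$\frac1{|\Lambda|}\mathbb E\Big(\operatorname{Tr}1_{(-\infty,E]}\big(\mathfrak c(T^{\mathcal D,\mathcal D}_{g,\Lambda})^\beta+V_\omega\big)\Big)\le N_f(E)\le\frac1{|\Lambda|}\mathbb E\Big(\operatorname{Tr}1_{(-\infty,E]}\big(\mathfrak c(T^{\mathcal N,\mathcal N}_{g,\Lambda})^\beta+V_\omega\big)\Big),$$ where $V_\omega$ is restricted to $\ell^2(\Lambda)$. Moreover, for all such $L$ and all $E\in\mathbb R$, almost surely $\liminf_{K\to\infty}n_K(E)$ is at least the left-hand side and $\limsup_{K\to\infty}n_K(E)$ is at most the right-hand side. -/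

import Mathlib

open MeasureTheory Filter Topology

noncomputable section

namespace LaurentIDS

/-! ### Laurent matrices and their finite-volume restrictions -/

/-- The Fourier coefficient `a_n = (1 / 2π) ∫_{-π}^{π} f(k) e^{-ikn} dk` of a real symbol. -/
def symbolCoeff (f : ℝ → ℝ) (n : ℤ) : ℂ :=
  (1 / (2 * Real.pi) : ℂ) *
    ∫ k in (-Real.pi)..Real.pi, (f k : ℂ) * Complex.exp (-Complex.I * k * n)

/-- The matrix, with respect to the canonical basis of `ℓ²(ℤ)`, of the Laurent operator
`(T_f x)_n = ∑_m a_{m-n} x_m`. -/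
def laurent (f : ℝ → ℝ) : Matrix ℤ ℤ ℂ :=
  Matrix.of fun n m => symbolCoeff f (m - n)

/-- The box `Λ_L = [-L, L] ∩ ℤ`. -/
abbrev Box (L : ℕ) : Type := Finset.Icc (-(L : ℤ)) (L : ℤ)

/-- The restriction `1_Λ T 1_Λ` to `ℓ²(Λ_L)` (simple boundary conditions). -/
def restrict (L : ℕ) (T : Matrix ℤ ℤ ℂ) : Matrix (Box L) (Box L) ℂ :=
  T.submatrix Subtype.val Subtype.val

/-- The restriction to `ℓ²(Λ_L)` of the multiplication operator `V_ω` by `ω : ℤ → ℝ`. -/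
def potential (L : ℕ) (ω : ℤ → ℝ) : Matrix (Box L) (Box L) ℂ :=
  Matrix.diagonal fun n => ((ω n : ℝ) : ℂ)

/-- `Tr 1_{(-∞, e]}(A)` for a Hermitian matrix `A`: the number of eigenvalues of `A` that are at
most `e`, counted with multiplicity. -/
def eigCount {ι : Type*} [Fintype ι] [DecidableEq ι] (A : Matrix ι ι ℂ) (e : ℝ) : ℕ := by
  classical
  exact A.charpoly.roots.countP fun z => z.re ≤ e

/-! ### The symbols -/

variable {M : ℕ}

/-- `f(x) = 𝔠 ∏_i (2 - 2 cos (x - E_i))^α`. -/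
def symbolF (c α : ℝ) (E : Fin M → Real.Angle) (x : ℝ) : ℝ :=
  c * ∏ i, (2 - 2 * ((x : Real.Angle) - E i).cos) ^ α

/-- `ᾱ`, the smallest natural number `n` with `α ≤ n`. -/
def alphaBar (α : ℝ) : ℕ := sInf {n : ℕ | α ≤ n}

/-- `g(x) = ∏_i (2 - 2 cos (x - E_i))^ᾱ`. -/
def symbolG (α : ℝ) (E : Fin M → Real.Angle) (x : ℝ) : ℝ :=
  ∏ i, (2 - 2 * ((x : Real.Angle) - E i).cos) ^ alphaBar α

/-- `N = M ᾱ`; the matrix `T_g` has band width `2 N + 1`. -/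
abbrev bandN (M : ℕ) (α : ℝ) : ℕ := M * alphaBar α

/-- The polynomial `p(z) = ∏_i (z - e^{i E_i})^ᾱ`, of degree `N`. It satisfies
`g(x) = |p(e^{ix})|²`, so that `T_g = A* A` for the one-sided difference operator
`(A ψ)(n) = ∑_{k=0}^{N} p_k ψ(n + k)`. -/
def factorPoly (α : ℝ) (E : Fin M → Real.Angle) : Polynomial ℂ :=
  ∏ i, (Polynomial.X - Polynomial.C ((E i).toCircle : ℂ)) ^ alphaBar α

/-! ### Modified Dirichlet and Neumann boundary conditions -/

/-- The triangular `N × N` matrix with entries `p_{j + m + 1}`: the part, inside a half line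
`[a, ∞)`, of the `N` rows `a - 1, …, a - N` of `A` whose stencil straddles the left endpoint. -/
def straddle (α : ℝ) (E : Fin M → Real.Angle) :
    Matrix (Fin (bandN M α)) (Fin (bandN M α)) ℂ :=
  Matrix.of fun m j => (factorPoly α E).coeff ((j : ℕ) + (m : ℕ) + 1)

/-- The matrix `B_D` of the modified Dirichlet boundary condition at a left endpoint. -/
def bcD (α : ℝ) (E : Fin M → Real.Angle) :
    Matrix (Fin (bandN M α)) (Fin (bandN M α)) ℂ :=
  (straddle α E).conjTranspose * straddle α E

/-- The matrix `B_N = -B_D` of the modified Neumann boundary condition at a left endpoint.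
With it the quadratic form of the restriction of `T_g` to a box `Λ` is the sum of
`|(A ψ)(n)|²` over those `n` for which the whole stencil `{n, …, n + N}` lies in `Λ`; its kernel
is the `N`-dimensional span of `n ↦ n^j e^{i E_k n}`, `j < ᾱ`, and this kernel determines the
matrix. For the discrete Laplacian (`M = 1`, `ᾱ = 1`, `E_1 = 0`) one gets `B_N = -1`. -/
def bcN (α : ℝ) (E : Fin M → Real.Angle) :
    Matrix (Fin (bandN M α)) (Fin (bandN M α)) ℂ :=
  -bcD α E

/-- The reflection of a square matrix along its anti-diagonal. -/
def antiReflect {N : ℕ} (B : Matrix (Fin N) (Fin N) ℂ) : Matrix (Fin N) (Fin N) ℂ :=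
  Matrix.of fun i j => B j.rev i.rev

/-- The matrix on `Λ_L` with block `B` in the upper left corner and zeros elsewhere. -/
def leftCorner (L : ℕ) {N : ℕ} (B : Matrix (Fin N) (Fin N) ℂ) : Matrix (Box L) (Box L) ℂ :=
  Matrix.of fun n m => ∑ i : Fin N, ∑ j : Fin N,
    if (n : ℤ) = -L + (i : ℕ) ∧ (m : ℤ) = -L + (j : ℕ) then B i j else 0

/-- The matrix on `Λ_L` with block `B` in the lower right corner and zeros elsewhere. -/
def rightCorner (L : ℕ) {N : ℕ} (B : Matrix (Fin N) (Fin N) ℂ) : Matrix (Box L) (Box L) ℂ :=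
  Matrix.of fun n m => ∑ i : Fin N, ∑ j : Fin N,
    if (n : ℤ) = L - (i.rev : ℕ) ∧ (m : ℤ) = L - (j.rev : ℕ) then B i j else 0

/-- `T_Λ + diag(B, 0, B̃)` on `Λ = Λ_L`, where `B̃` is the reflection of `B` along the
anti-diagonal. -/
def withBC (L : ℕ) (T : Matrix ℤ ℤ ℂ) {N : ℕ} (B : Matrix (Fin N) (Fin N) ℂ) :
    Matrix (Box L) (Box L) ℂ :=
  restrict L T + leftCorner L B + rightCorner L (antiReflect B)

/-- `T_{g,Λ}^{D,D}` on `Λ = Λ_L`. -/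
def dirichlet (α : ℝ) (E : Fin M → Real.Angle) (L : ℕ) : Matrix (Box L) (Box L) ℂ :=
  withBC L (laurent (symbolG α E)) (bcD α E)

/-- `T_{g,Λ}^{N,N}` on `Λ = Λ_L`. -/
def neumann (α : ℝ) (E : Fin M → Real.Angle) (L : ℕ) : Matrix (Box L) (Box L) ℂ :=
  withBC L (laurent (symbolG α E)) (bcN α E)

/-- The power `A^β` of a non-negative Hermitian matrix, through the functional calculus. -/
def matPow {ι : Type*} [Fintype ι] [DecidableEq ι] (A : Matrix ι ι ℂ) (β : ℝ) : Matrix ι ι ℂ :=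
  cfc (fun x : ℝ => x ^ β) A

/-! ### The Anderson potential and the integrated density of states -/

/-- The law `⨂_ℤ P₀` of the i.i.d. family `ω = (ω_n)`. -/
def law (P₀ : Measure ℝ) [IsProbabilityMeasure P₀] : Measure (ℤ → ℝ) :=
  Measure.infinitePi fun _ : ℤ => P₀

/-- The restriction `H_{f,L} = 1_Λ (T_f + V_ω) 1_Λ` to `ℓ²(Λ_L)`. -/
def hamiltonian (f : ℝ → ℝ) (L : ℕ) (ω : ℤ → ℝ) : Matrix (Box L) (Box L) ℂ :=
  restrict L (laurent f) + potential L ω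

/-- `#{j : μ_j ≤ e} / (2L+1)`, where the `μ_j` are the eigenvalues of `H_{f,L}`. -/
def normalizedCount (f : ℝ → ℝ) (L : ℕ) (ω : ℤ → ℝ) (e : ℝ) : ℝ :=
  (eigCount (hamiltonian f L ω) e : ℝ) / (2 * L + 1)

/-- `Nf` is the integrated density of states of `H_f = T_f + V_ω`: the non-decreasing,
right-continuous function to which the normalized eigenvalue counting functions converge almost
surely, at all points of continuity. (These conditions determine `Nf`.) -/
structure IsIDS (f : ℝ → ℝ) (P₀ : Measure ℝ) [IsProbabilityMeasure P₀] (Nf : ℝ → ℝ) : Prop where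
  mono : Monotone Nf
  rightCts : ∀ e, ContinuousWithinAt Nf (Set.Ici e) e
  lim : ∀ᵐ ω ∂law P₀, ∀ e, ContinuousAt Nf e →
    Tendsto (fun L : ℕ => normalizedCount f L ω e) atTop (𝓝 (Nf e))

/-- `|Λ|⁻¹ 𝔼 (Tr 1_{(-∞, e]} (A + V_ω))` for a matrix `A` on `Λ = Λ_L`. -/
def expectedCount (P₀ : Measure ℝ) [IsProbabilityMeasure P₀] (L : ℕ)
    (A : Matrix (Box L) (Box L) ℂ) (e : ℝ) : ℝ :=
  (∫ ω, (eigCount (A + potential L ω) e : ℝ) ∂law P₀) / (2 * L + 1)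

/-! ### The factorizations `f = 𝔠 g^β`, `g(x) = |p(e^{ix})|²`, and Hermiticity of the matrices -/

theorem le_alphaBar (α : ℝ) : α ≤ alphaBar α :=
  Nat.sInf_mem (s := {n : ℕ | α ≤ n}) (exists_nat_ge α)

theorem symbolF_eq (c : ℝ) {α : ℝ} (hα : 0 < α) (E : Fin M → Real.Angle) (x : ℝ) :
    symbolF c α E x = c * symbolG α E x ^ (α / alphaBar α) := by
  have h (i) : 0 ≤ 2 - 2 * ((x : Real.Angle) - E i).cos := by
    induction ((x : Real.Angle) - E i) using Real.Angle.induction_on with | _ t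
    rw [Real.Angle.cos_coe]
    linarith [Real.cos_le_one t]
  have ha : (alphaBar α : ℝ) ≠ 0 := (hα.trans_le (le_alphaBar α)).ne'
  rw [symbolF, symbolG, ← Real.finsetProd_rpow _ _ fun i _ => pow_nonneg (h i) _]
  congr 1
  refine Finset.prod_congr rfl fun i _ => ?_
  rw [← Real.rpow_natCast, ← Real.rpow_mul (h i), mul_div_cancel₀ _ ha]

theorem symbolG_eq (α : ℝ) (E : Fin M → Real.Angle) (x : ℝ) :
    symbolG α E x = ‖(factorPoly α E).eval ((x : Real.Angle).toCircle : ℂ)‖ ^ 2 := by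
  rw [symbolG, factorPoly, Polynomial.eval_prod, norm_prod, ← Finset.prod_pow]
  refine Finset.prod_congr rfl fun i _ => ?_
  rw [Polynomial.eval_pow, norm_pow, pow_right_comm]
  congr 1
  induction E i using Real.Angle.induction_on with | _ t
  rw [← Real.Angle.coe_sub, Real.Angle.cos_coe, Real.cos_sub]
  simp only [Polynomial.eval_sub, Polynomial.eval_X, Polynomial.eval_C, Real.Angle.coe_toCircle,
    Real.Angle.cos_coe, Real.Angle.sin_coe, ← Complex.normSq_eq_norm_sq, Complex.normSq_apply]
  simp [Complex.cos_ofReal_re, Complex.sin_ofReal_re]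
  nlinarith [Real.sin_sq_add_cos_sq x, Real.sin_sq_add_cos_sq t]


theorem symbolCoeff_neg (f : ℝ → ℝ) (n : ℤ) :
    symbolCoeff f (-n) = star (symbolCoeff f n) := by
  have h : (starRingEnd ℂ) (∫ k in (-Real.pi)..Real.pi,
      (f k : ℂ) * Complex.exp (-Complex.I * k * n)) =
      ∫ k in (-Real.pi)..Real.pi, (f k : ℂ) * Complex.exp (-Complex.I * k * (-n : ℤ)) := by
    rw [intervalIntegral, intervalIntegral, map_sub, ← integral_conj, ← integral_conj,
      ← intervalIntegral]
    congr 1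
    funext k
    rw [map_mul, Complex.conj_ofReal, ← Complex.exp_conj]
    simp
  simp only [symbolCoeff, Complex.star_def, map_mul, h]
  congr 1
  simp [Complex.conj_ofNat]

theorem restrict_laurent_isHermitian (f : ℝ → ℝ) (L : ℕ) :
    (restrict L (laurent f)).IsHermitian := by
  ext n m
  simp only [restrict, laurent, Matrix.conjTranspose_apply, Matrix.submatrix_apply,
    Matrix.of_apply, ← symbolCoeff_neg, neg_sub]

theorem withBC_isHermitian (f : ℝ → ℝ) (L : ℕ) {N : ℕ} {B : Matrix (Fin N) (Fin N) ℂ}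
    (hB : B.IsHermitian) : (withBC L (laurent f) B).IsHermitian := by
  have h (i j) : star (B i j) = B j i := hB.apply j i
  refine ((restrict_laurent_isHermitian f L).add ?_).add ?_
  · ext n m
    simp only [leftCorner, Matrix.conjTranspose_apply, Matrix.of_apply, star_sum]
    rw [Finset.sum_comm]
    refine Finset.sum_congr rfl fun i _ => Finset.sum_congr rfl fun j _ => ?_
    rw [apply_ite star, star_zero, h]
    exact if_congr and_comm rfl rfl
  · ext n m
    simp only [rightCorner, antiReflect, Matrix.conjTranspose_apply, Matrix.of_apply, star_sum]
    rw [Finset.sum_comm]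
    refine Finset.sum_congr rfl fun i _ => Finset.sum_congr rfl fun j _ => ?_
    rw [apply_ite star, star_zero, h]
    exact if_congr and_comm rfl rfl

theorem dirichlet_isHermitian (α : ℝ) (E : Fin M → Real.Angle) (L : ℕ) :
    (dirichlet α E L).IsHermitian :=
  withBC_isHermitian _ L (Matrix.isHermitian_conjTranspose_mul_self _)

theorem neumann_isHermitian (α : ℝ) (E : Fin M → Real.Angle) (L : ℕ) :
    (neumann α E L).IsHermitian :=
  withBC_isHermitian _ L (Matrix.isHermitian_conjTranspose_mul_self _).neg

end LaurentIDS

end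

/-! Since `g = |p|²` on the unit circle, `T_g = A* A` for the one-sided difference operator `A` with
coefficients `p_k`, so the form of `T_g` is the sum of `|(A ψ)(r)|²` over all rows `r`. Cut `ℤ` into
translates of `Λ_L`, the tiles. A row whose stencil lies inside one tile sees that tile only. Any
other stencil meets at most two tiles, because `N ≤ 2L + 1`. The matrix `B_D` counts the straddling
rows of a tile twice, which dominates them by `|a + b|² ≤ 2|a|² + 2|b|²`, and `B_N` drops them.
Hence the direct sum of the Neumann matrices lies below `T_g` and that of the Dirichlet matrices
above it (`quadForm_withBC`, `norm_diffRow_sq_le`, `sum_rowWeight_mul_le`).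

As `β ≤ 1`, Löwner-Heinz carries both inequalities over to `T_f = 𝔠 T_g ^ β`. It has to be used on
the whole lattice, since the power of a restriction of `T_g` is not the restriction of the power;
compression to finitely many tiles comes afterwards (`quadForm_laurent_le`, `le_quadForm_laurent`).
The potential is diagonal and respects the tiles.

By min-max, a larger form has fewer eigenvalues below `e`, and by interlacing each site of `Λ_K`
outside the tiles changes the count by at most one. The counts of the separate tiles are bounded and
i.i.d., so the strong law turns their average into `expectedCount`; this gives the almost sure
bounds on `liminf` and `limsup`.

For existence, the Dirichlet and Neumann matrices differ by a rank bounded in `L`. Approximating `𝔠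
x ^ β` by a polynomial shows that the two expected counts differ by `O(1 / L)` up to a small energy
shift (`exists_expectedCount_neumann_le`), so both bounds determine the same right-continuous
function. The bounds on `N_f` hold at its continuity points and extend to all energies by
right-continuity. -/

noncomputable section

namespace LaurentIDS

/-! ### Eigenvalue counts: min-max, interlacing, direct sums -/

section Counting

open Matrix

variable {ι κ : Type*} [Fintype ι] [Fintype κ]

/-- The quadratic form `x ↦ Re ⟨x, A x⟩` of a square matrix. -/
def quadForm (A : Matrix ι ι ℂ) (x : ι → ℂ) : ℝ := (star x ⬝ᵥ A *ᵥ x).re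

/-- The squared Euclidean norm of a vector. -/
def normSq (x : ι → ℂ) : ℝ := ∑ i, ‖x i‖ ^ 2

theorem normSq_nonneg (x : ι → ℂ) : 0 ≤ normSq x :=
  Finset.sum_nonneg fun _ _ => sq_nonneg _

theorem normSq_eq_zero {x : ι → ℂ} : normSq x = 0 ↔ x = 0 := by
  rw [normSq, Finset.sum_eq_zero_iff_of_nonneg fun _ _ => sq_nonneg _]
  simp [funext_iff]

theorem normSq_eq_dotProduct (x : ι → ℂ) : normSq x = (star x ⬝ᵥ x).re := by
  simp only [normSq, dotProduct, Complex.re_sum, Pi.star_apply]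
  refine Finset.sum_congr rfl fun i _ => ?_
  rw [← Complex.normSq_eq_norm_sq, Complex.star_def, ← Complex.normSq_eq_conj_mul_self,
    Complex.ofReal_re]

theorem quadForm_add (A B : Matrix ι ι ℂ) (x : ι → ℂ) :
    quadForm (A + B) x = quadForm A x + quadForm B x := by
  simp [quadForm, add_mulVec]

theorem quadForm_smul (c : ℝ) (A : Matrix ι ι ℂ) (x : ι → ℂ) :
    quadForm ((c : ℂ) • A) x = c * quadForm A x := by
  simp [quadForm, smul_mulVec]

theorem quadForm_conjTranspose_mul_mul (R : Matrix κ ι ℂ) (A : Matrix κ κ ℂ) (x : ι → ℂ) :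
    quadForm (Rᴴ * A * R) x = quadForm A (R *ᵥ x) := by
  rw [quadForm, quadForm, ← mulVec_mulVec, ← mulVec_mulVec, dotProduct_mulVec, ← star_mulVec]

variable [DecidableEq ι] [DecidableEq κ]

theorem quadForm_one (x : ι → ℂ) : quadForm 1 x = normSq x := by
  rw [quadForm, one_mulVec, normSq_eq_dotProduct]

theorem quadForm_diagonal (d : ι → ℝ) (x : ι → ℂ) :
    quadForm (diagonal fun i => (d i : ℂ)) x = ∑ i, d i * ‖x i‖ ^ 2 := by
  simp only [quadForm, dotProduct, Complex.re_sum, Pi.star_apply, mulVec_diagonal]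
  refine Finset.sum_congr rfl fun i _ => ?_
  rw [← Complex.normSq_eq_norm_sq, mul_left_comm, Complex.star_def,
    ← Complex.normSq_eq_conj_mul_self, ← Complex.ofReal_mul, Complex.ofReal_re]

variable {A : Matrix ι ι ℂ} {B : Matrix κ κ ℂ}

theorem normSq_star_eigenvectorUnitary_mulVec (hA : A.IsHermitian) (x : ι → ℂ) :
    normSq ((star (hA.eigenvectorUnitary : Matrix ι ι ℂ)) *ᵥ x) = normSq x := by
  rw [← quadForm_one, ← quadForm_conjTranspose_mul_mul, ← star_eq_conjTranspose, star_star,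
    mul_one, Unitary.mul_star_self_of_mem (SetLike.coe_mem _), quadForm_one]

theorem quadForm_eq_sum_eigenvalues (hA : A.IsHermitian) (x : ι → ℂ) :
    quadForm A x = ∑ i, hA.eigenvalues i *
      ‖((star (hA.eigenvectorUnitary : Matrix ι ι ℂ)) *ᵥ x) i‖ ^ 2 := by
  rw [← quadForm_diagonal, ← quadForm_conjTranspose_mul_mul, ← star_eq_conjTranspose, star_star]
  congr 1
  conv_lhs => rw [hA.spectral_theorem, Unitary.conjStarAlgAut_apply]
  rfl

open scoped Classical in
theorem eigCount_eq_card (hA : A.IsHermitian) (e : ℝ) :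
    eigCount A e = Fintype.card {i // hA.eigenvalues i ≤ e} := by
  rw [eigCount, hA.roots_charpoly_eq_eigenvalues, Multiset.countP_map, Fintype.card_subtype]
  simp only [Function.comp_apply, Complex.coe_algebraMap,
    Complex.ofReal_re]
  rfl

/-- One half of the min-max principle: a subspace on which the form is at most `e` has dimension
at most the number of eigenvalues that are at most `e`. -/
theorem finrank_le_eigCount (hB : B.IsHermitian) {e : ℝ} (W : Submodule ℂ (κ → ℂ))
    (h : ∀ x ∈ W, quadForm B x ≤ e * normSq x) : Module.finrank ℂ W ≤ eigCount B e := by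
  classical
  rw [eigCount_eq_card hB]
  let U : Matrix κ κ ℂ := star (hB.eigenvectorUnitary : Matrix κ κ ℂ)
  let φ : (κ → ℂ) →ₗ[ℂ] ({i // hB.eigenvalues i ≤ e} → ℂ) :=
    LinearMap.funLeft ℂ ℂ Subtype.val ∘ₗ U.mulVecLin
  -- The coordinates along the eigenvectors with eigenvalue at most `e` determine a vector of `W`:
  -- if they all vanish, the form exceeds `e * normSq x` unless `x = 0`.
  have key : Function.Injective (φ ∘ₗ W.subtype) := by
    rw [← LinearMap.ker_eq_bot, LinearMap.ker_eq_bot']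
    rintro ⟨x, hx⟩ h0
    have h0' : ∀ i, hB.eigenvalues i ≤ e → (U *ᵥ x) i = 0 := fun i hi => congrFun h0 ⟨i, hi⟩
    have h1 := h x hx
    rw [quadForm_eq_sum_eigenvalues hB, ← normSq_star_eigenvectorUnitary_mulVec hB, normSq,
      Finset.mul_sum, ← sub_nonpos, ← Finset.sum_sub_distrib] at h1
    have h2 : ∀ i ∈ Finset.univ, 0 ≤ hB.eigenvalues i * ‖(U *ᵥ x) i‖ ^ 2 -
        e * ‖(U *ᵥ x) i‖ ^ 2 := by
      intro i _
      by_cases hi : hB.eigenvalues i ≤ e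
      · simp [h0' i hi]
      · rw [← sub_mul]
        have := sub_pos.2 (not_le.1 hi)
        positivity
    have h3 := (Finset.sum_eq_zero_iff_of_nonneg h2).1 (le_antisymm h1 (Finset.sum_nonneg h2))
    have h4 : U *ᵥ x = 0 := by
      funext i
      by_cases hi : hB.eigenvalues i ≤ e
      · exact h0' i hi
      · have := h3 i (Finset.mem_univ i)
        rw [← sub_mul] at this
        simpa [sub_eq_zero, (not_le.1 hi).ne'] using this
    have h5 := normSq_star_eigenvectorUnitary_mulVec hB x
    rw [show (star (hB.eigenvectorUnitary : Matrix κ κ ℂ)) *ᵥ x = 0 from h4,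
      normSq_eq_zero.2 rfl] at h5
    exact Subtype.ext (normSq_eq_zero.1 h5.symm)
  simpa using LinearMap.finrank_le_finrank_of_injective key

/-- Comparison of eigenvalue counts: if the form of `B`, pulled back along a map `J`, is
bounded by that of `A` up to `δ` on the kernel of a linear map `D`, where `J` is isometric. -/
theorem eigCount_le_eigCount_add_finrank (hA : A.IsHermitian) (hB : B.IsHermitian)
    {V : Type*} [AddCommGroup V] [Module ℂ V] [FiniteDimensional ℂ V]
    (J : (ι → ℂ) →ₗ[ℂ] (κ → ℂ)) (D : (ι → ℂ) →ₗ[ℂ] V)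
    (hJ : ∀ x, D x = 0 → normSq (J x) = normSq x) (e δ : ℝ)
    (h : ∀ x, D x = 0 → quadForm B (J x) ≤ quadForm A x + δ * normSq x) :
    eigCount A e ≤ eigCount B (e + δ) + Module.finrank ℂ V := by
  classical
  let U : Matrix ι ι ℂ := star (hA.eigenvectorUnitary : Matrix ι ι ℂ)
  let φ : (ι → ℂ) →ₗ[ℂ] ({i // ¬ hA.eigenvalues i ≤ e} → ℂ) :=
    LinearMap.funLeft ℂ ℂ Subtype.val ∘ₗ U.mulVecLin
  -- `W` is the spectral subspace of `A` up to `e`, cut with the kernel of `D`. Its dimension is at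
  -- least `eigCount A e - finrank V`, and `J` embeds it into a space where the form of `B` is at
  -- most `e + δ`.
  let W := LinearMap.ker (φ.prod D)
  have hW : ∀ x ∈ W, (∀ i, ¬ hA.eigenvalues i ≤ e → (U *ᵥ x) i = 0) ∧ D x = 0 := by
    intro x hx
    rw [LinearMap.mem_ker, LinearMap.prod_apply] at hx
    replace hx := Prod.mk_eq_zero.1 hx
    exact ⟨fun i hi => congrFun hx.1 ⟨i, hi⟩, hx.2⟩
  have hJi : Function.Injective (J ∘ₗ W.subtype) := by
    rw [← LinearMap.ker_eq_bot, LinearMap.ker_eq_bot']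
    rintro ⟨x, hx⟩ hx0
    have hx0 : J x = 0 := hx0
    exact Subtype.ext (normSq_eq_zero.1 (by rw [← hJ x (hW x hx).2, hx0, normSq_eq_zero]))
  have h1 : Module.finrank ℂ (LinearMap.range (J ∘ₗ W.subtype)) ≤ eigCount B (e + δ) := by
    refine finrank_le_eigCount hB _ ?_
    rintro _ ⟨⟨x, hx⟩, rfl⟩
    obtain ⟨h0, hD⟩ := hW x hx
    refine (h x hD).trans ?_
    rw [LinearMap.comp_apply, Submodule.subtype_apply, hJ x hD, add_mul]
    gcongr
    rw [quadForm_eq_sum_eigenvalues hA, ← normSq_star_eigenvectorUnitary_mulVec hA, normSq,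
      Finset.mul_sum]
    refine Finset.sum_le_sum fun i _ => ?_
    by_cases hi : hA.eigenvalues i ≤ e
    · gcongr
    · have := h0 i hi
      simp only [U] at this
      simp [this]
  rw [LinearMap.finrank_range_of_inj hJi] at h1
  have h2 := (φ.prod D).finrank_range_add_finrank_ker
  have h3 := Submodule.finrank_le (LinearMap.range (φ.prod D))
  rw [Module.finrank_prod, Module.finrank_fintype_fun_eq_card] at h3
  rw [Module.finrank_fintype_fun_eq_card] at h2
  have h4 := Fintype.card_subtype_compl (fun i => hA.eigenvalues i ≤ e)
  have h5 := Fintype.card_subtype_le (fun i => hA.eigenvalues i ≤ e)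
  rw [eigCount_eq_card hA]
  change _ + Module.finrank ℂ W = _ at h2
  omega

/-- The shift `δ` is kept because it also yields monotonicity in the energy and semicontinuity in
the potential. -/
theorem eigCount_le_of_quadForm_le {A B : Matrix ι ι ℂ} (hA : A.IsHermitian) (hB : B.IsHermitian)
    (e δ : ℝ) (h : ∀ x, quadForm B x ≤ quadForm A x + δ * normSq x) :
    eigCount A e ≤ eigCount B (e + δ) := by
  simpa using eigCount_le_eigCount_add_finrank hA hB LinearMap.id
    (0 : (ι → ℂ) →ₗ[ℂ] (Fin 0 → ℂ)) (fun _ _ => rfl) e δ (fun x _ => h x)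

theorem eigCount_mono (hA : A.IsHermitian) : Monotone (eigCount A) := by
  intro e e' h
  have := eigCount_le_of_quadForm_le hA hA e (e' - e)
    (fun x => by nlinarith [normSq_nonneg x])
  simpa using this

/-- Extension of a vector by zero along an injection. -/
def extendLin (σ : ι → κ) : (ι → ℂ) →ₗ[ℂ] (κ → ℂ) where
  toFun x k := ∑ i, if σ i = k then x i else 0
  map_add' x y := by
    funext k
    simp only [Pi.add_apply, ← Finset.sum_add_distrib]
    exact Finset.sum_congr rfl fun i _ => by split_ifs <;> simp
  map_smul' c x := by
    funext k
    simp only [Pi.smul_apply, smul_eq_mul, RingHom.id_apply, Finset.mul_sum]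
    exact Finset.sum_congr rfl fun i _ => by split_ifs <;> simp

omit [Fintype κ] [DecidableEq ι] in
theorem extendLin_apply (σ : ι → κ) (x : ι → ℂ) (k : κ) :
    extendLin σ x k = ∑ i, if σ i = k then x i else 0 := rfl

omit [Fintype κ] [DecidableEq ι] in
theorem extendLin_apply_of_injective {σ : ι → κ} (hσ : Function.Injective σ) (x : ι → ℂ) (i : ι) :
    extendLin σ x (σ i) = x i := by
  classical
  simp [extendLin_apply, hσ.eq_iff]

omit [Fintype κ] [DecidableEq ι] in
theorem extendLin_apply_of_notMem {σ : ι → κ} (x : ι → ℂ) {k : κ} (hk : k ∉ Set.range σ) :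
    extendLin σ x k = 0 :=
  Finset.sum_eq_zero fun i _ => if_neg fun h => hk ⟨i, h⟩

omit [DecidableEq ι] in
theorem sum_extendLin {β : Type*} [AddCommMonoid β] {σ : ι → κ} (hσ : Function.Injective σ)
    (x : ι → ℂ) (F : κ → ℂ → β) (hF : ∀ k, F k 0 = 0) :
    ∑ k, F k (extendLin σ x k) = ∑ i, F (σ i) (x i) := by
  classical
  rw [← Finset.sum_subset (Finset.subset_univ (Finset.univ.image σ)),
    Finset.sum_image hσ.injOn]
  · simp [extendLin_apply_of_injective hσ]
  · intro k _ hk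
    rw [extendLin_apply_of_notMem x (by simpa using hk), hF]

omit [DecidableEq ι] in
theorem normSq_extendLin {σ : ι → κ} (hσ : Function.Injective σ) (x : ι → ℂ) :
    normSq (extendLin σ x) = normSq x :=
  sum_extendLin hσ x (fun _ z => ‖z‖ ^ 2) (by simp)

omit [DecidableEq ι] in
theorem quadForm_extendLin {σ : ι → κ} (hσ : Function.Injective σ) (B : Matrix κ κ ℂ)
    (x : ι → ℂ) : quadForm B (extendLin σ x) = quadForm (B.submatrix σ σ) x := by
  simp only [quadForm, dotProduct, mulVec, Pi.star_apply, submatrix_apply]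
  congr 1
  rw [sum_extendLin hσ x (fun k z => star z * ∑ l, B k l * extendLin σ x l) (by simp)]
  refine Finset.sum_congr rfl fun i _ => ?_
  rw [sum_extendLin hσ x (fun k z => B (σ i) k * z) (by simp)]

/-- Cauchy interlacing, lower bound. -/
theorem eigCount_submatrix_le {σ : ι → κ} (hσ : Function.Injective σ) (hB : B.IsHermitian)
    (e : ℝ) : eigCount (B.submatrix σ σ) e ≤ eigCount B e := by
  simpa using eigCount_le_eigCount_add_finrank (hB.submatrix σ) hB (extendLin σ)
    (0 : (ι → ℂ) →ₗ[ℂ] (Fin 0 → ℂ)) (fun x _ => normSq_extendLin hσ x) e 0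
    (fun x _ => by rw [quadForm_extendLin hσ]; simp)

/-- Cauchy interlacing, upper bound. -/
theorem eigCount_le_submatrix_add {σ : ι → κ} (hσ : Function.Injective σ) (hB : B.IsHermitian)
    (e : ℝ) : eigCount B e ≤
      eigCount (B.submatrix σ σ) e + (Fintype.card κ - Fintype.card ι) := by
  classical
  have hcard : Fintype.card {k // k ∉ Set.range σ} = Fintype.card κ - Fintype.card ι := by
    rw [Fintype.card_subtype_compl, ← Set.card_range_of_injective hσ]
  -- The kernel of `D` consists of the vectors supported on the range of `σ`, where restriction
  -- along `σ` is isometric and preserves the form.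
  let D : (κ → ℂ) →ₗ[ℂ] ({k // k ∉ Set.range σ} → ℂ) := LinearMap.funLeft ℂ ℂ Subtype.val
  have hD : ∀ x, D x = 0 → extendLin σ (LinearMap.funLeft ℂ ℂ σ x) = x := by
    intro x hx
    funext k
    by_cases hk : k ∈ Set.range σ
    · obtain ⟨i, rfl⟩ := hk
      rw [extendLin_apply_of_injective hσ]
      rfl
    · rw [extendLin_apply_of_notMem _ hk]
      exact (congrFun hx ⟨k, hk⟩).symm
  rw [← hcard]
  have := eigCount_le_eigCount_add_finrank hB (hB.submatrix σ) (LinearMap.funLeft ℂ ℂ σ) D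
    (fun x hx => by rw [← normSq_extendLin hσ, hD x hx]) e 0
    (fun x hx => by rw [← quadForm_extendLin hσ, hD x hx]; simp)
  simpa [- Fintype.card_subtype_compl] using this

theorem eigCount_le_card (hA : A.IsHermitian) (e : ℝ) : eigCount A e ≤ Fintype.card ι := by
  classical
  rw [eigCount_eq_card hA]
  exact Fintype.card_subtype_le _

theorem charpoly_blockDiagonal {R : Type*} [CommRing R] (X : κ → Matrix ι ι R) :
    (blockDiagonal X).charpoly = ∏ t, (X t).charpoly := by
  rw [charpoly, show charmatrix (blockDiagonal X) = blockDiagonal fun t => charmatrix (X t) from ?_,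
    det_blockDiagonal]
  · rfl
  · ext ⟨i, s⟩ ⟨j, t⟩
    simp only [charmatrix_apply, blockDiagonal_apply, diagonal_apply, Prod.mk.injEq]
    by_cases h : s = t <;> simp [h]

theorem eigCount_blockDiagonal (X : κ → Matrix ι ι ℂ) (e : ℝ) :
    eigCount (blockDiagonal X) e = ∑ t, eigCount (X t) e := by
  classical
  have h : ∏ t, (X t).charpoly ≠ 0 :=
    Finset.prod_ne_zero_iff.2 fun t _ => (charpoly_monic _).ne_zero
  rw [eigCount, charpoly_blockDiagonal, Polynomial.roots_prod _ _ h]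
  simp only [eigCount]
  induction (Finset.univ : Finset κ) using Finset.induction_on with
  | empty => simp
  | insert a s ha ih =>
    rw [Finset.insert_val, Multiset.ndinsert_of_notMem ha, Multiset.cons_bind,
      Multiset.countP_add, ih, Finset.sum_insert ha]

end Counting

end LaurentIDS

end

noncomputable section

namespace LaurentIDS

/-! ### Löwner-Heinz followed by compression to a subspace -/

section Compression

open Matrix ContinuousLinearMap

open scoped InnerProductSpace

variable {H : Type*} [NormedAddCommGroup H] [InnerProductSpace ℂ H] [CompleteSpace H]
  {ι : Type*} [Fintype ι] [DecidableEq ι]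

theorem re_inner_toEuclideanCLM (A : Matrix ι ι ℂ) (x : EuclideanSpace ℂ ι) :
    (⟪x, toEuclideanCLM (𝕜 := ℂ) A x⟫_ℂ).re = quadForm A x.ofLp := by
  rw [EuclideanSpace.inner_eq_star_dotProduct, dotProduct_comm]
  rfl

variable (J : EuclideanSpace ℂ ι →ₗᵢ[ℂ] H)

omit [DecidableEq ι] in
theorem adjoint_isometry_apply (x : EuclideanSpace ℂ ι) :
    adjoint J.toContinuousLinearMap (J x) = x := by
  refine ext_inner_left ℂ fun y => ?_
  rw [adjoint_inner_right]
  exact J.inner_map_map y x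

/-- The star homomorphism `(X, z) ↦ J X J* + z (1 - J J*)` attached to an isometry `J`. -/
def cornerHom :
    ((EuclideanSpace ℂ ι →L[ℂ] EuclideanSpace ℂ ι) × ℂ) →⋆ₐ[ℂ] (H →L[ℂ] H) where
  toFun X := J.toContinuousLinearMap ∘L X.1 ∘L adjoint J.toContinuousLinearMap +
    X.2 • (1 - J.toContinuousLinearMap ∘L adjoint J.toContinuousLinearMap)
  map_one' := by
    ext x
    simp
  map_mul' X Y := by
    ext x
    simp [adjoint_isometry_apply, smul_sub, mul_smul, map_sub]
  map_zero' := by simp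
  map_add' X Y := by
    ext x
    simp [add_smul]
    abel
  commutes' z := by
    ext x
    simp [Algebra.algebraMap_eq_smul_one, smul_sub]
  map_star' X := by
    simp only [star_eq_adjoint, Prod.fst_star, Prod.snd_star, map_add, adjoint_comp,
      adjoint_adjoint, map_smulₛₗ, map_sub]
    rw [show adjoint (1 : H →L[ℂ] H) = 1 from star_one (H →L[ℂ] H)]
    simp [ContinuousLinearMap.comp_assoc]

omit [DecidableEq ι] in
theorem cornerHom_apply (X : (EuclideanSpace ℂ ι →L[ℂ] EuclideanSpace ℂ ι) × ℂ) (ψ : H) :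
    cornerHom J X ψ = J (X.1 (adjoint J.toContinuousLinearMap ψ)) +
      X.2 • (ψ - J (adjoint J.toContinuousLinearMap ψ)) := rfl

omit [DecidableEq ι] in
theorem continuous_cornerHom : Continuous (cornerHom J) := by
  change Continuous fun X : (EuclideanSpace ℂ ι →L[ℂ] EuclideanSpace ℂ ι) × ℂ =>
    J.toContinuousLinearMap ∘L X.1 ∘L adjoint J.toContinuousLinearMap +
    X.2 • (1 - J.toContinuousLinearMap ∘L adjoint J.toContinuousLinearMap)
  fun_prop

omit [DecidableEq ι] in
theorem norm_sub_isometry_sq (ψ : H) :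
    ‖ψ - J (adjoint J.toContinuousLinearMap ψ)‖ ^ 2 =
      (⟪ψ, ψ - J (adjoint J.toContinuousLinearMap ψ)⟫_ℂ).re := by
  rw [← inner_self_eq_norm_sq (𝕜 := ℂ)]
  conv_lhs => rw [inner_sub_left]
  have : ⟪J (adjoint J.toContinuousLinearMap ψ),
      ψ - J (adjoint J.toContinuousLinearMap ψ)⟫_ℂ = 0 := by
    rw [← J.coe_toContinuousLinearMap, ← adjoint_inner_right, map_sub]
    simp [adjoint_isometry_apply]
  rw [this, sub_zero]
  rfl

theorem re_inner_cornerHom (X : Matrix ι ι ℂ) (C : ℝ) (ψ : H) :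
    (⟪ψ, cornerHom J (toEuclideanCLM (𝕜 := ℂ) X, (C : ℂ)) ψ⟫_ℂ).re =
      quadForm X (adjoint J.toContinuousLinearMap ψ).ofLp +
        C * ‖ψ - J (adjoint J.toContinuousLinearMap ψ)‖ ^ 2 := by
  rw [cornerHom_apply, inner_add_right, Complex.add_re, norm_sub_isometry_sq, inner_smul_right,
    Complex.re_ofReal_mul, ← re_inner_toEuclideanCLM, ← J.coe_toContinuousLinearMap,
    ← adjoint_inner_left]

theorem continuous_toEuclideanCLM :
    Continuous (toEuclideanCLM (n := ι) (𝕜 := ℂ)) :=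
  LinearMap.continuous_of_finiteDimensional
    (toEuclideanCLM (n := ι) (𝕜 := ℂ)).toAlgEquiv.toLinearMap

theorem isSelfAdjoint_toEuclideanCLM {X : Matrix ι ι ℂ} (hX : X.IsHermitian) :
    IsSelfAdjoint (toEuclideanCLM (𝕜 := ℂ) X) := by
  rw [isSelfAdjoint_iff, ← map_star, star_eq_conjTranspose, hX.eq]

theorem prod_continuousFunctionalCalculus (A B : Type*) [CStarAlgebra A] [CStarAlgebra B] :
    ContinuousFunctionalCalculus ℝ (A × B) IsSelfAdjoint :=
  IsSelfAdjoint.instContinuousFunctionalCalculus (A := A × B)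

/-- Star homomorphisms commute with the functional calculus, which acts componentwise on a product
and by evaluation on scalars. The second factor `ℂ` carries the constant on the orthogonal
complement of the range of `J`. -/
theorem cfc_cornerHom {f : ℝ → ℝ} (hf : Continuous f) {X : Matrix ι ι ℂ} (hX : X.IsHermitian)
    (C : ℝ) : cfc f (cornerHom J (toEuclideanCLM (𝕜 := ℂ) X, (C : ℂ))) =
      cornerHom J (toEuclideanCLM (𝕜 := ℂ) (cfc f X), ((f C : ℝ) : ℂ)) := by
  have h1 : IsSelfAdjoint (toEuclideanCLM (𝕜 := ℂ) X) := isSelfAdjoint_toEuclideanCLM hX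
  have h2 : IsSelfAdjoint ((C : ℝ) : ℂ) := Complex.conj_ofReal C
  have h3 : IsSelfAdjoint ((toEuclideanCLM (𝕜 := ℂ) X, (C : ℂ)) :
    (EuclideanSpace ℂ ι →L[ℂ] EuclideanSpace ℂ ι) × ℂ) := Prod.ext h1 h2
  have := prod_continuousFunctionalCalculus (EuclideanSpace ℂ ι →L[ℂ] EuclideanSpace ℂ ι) ℂ
  rw [← StarAlgHomClass.map_cfc (cornerHom J) f _ hf.continuousOn (continuous_cornerHom J) h3
    (h3.map _), cfc_map_prod (S := ℂ) f _ _ hf.continuousOn h3 h1 h2,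
    ← StarAlgHomClass.map_cfc (toEuclideanCLM (n := ι) (𝕜 := ℂ)) f X hf.continuousOn
      continuous_toEuclideanCLM hX h1]
  congr 3
  exact cfc_algebraMap (A := ℂ) C f

theorem clm_le_of_forall_re_inner_le {S T : H →L[ℂ] H} (hS : IsSelfAdjoint S)
    (hT : IsSelfAdjoint T) (h : ∀ ψ, (⟪ψ, S ψ⟫_ℂ).re ≤ (⟪ψ, T ψ⟫_ℂ).re) : S ≤ T := by
  rw [ContinuousLinearMap.le_def, ContinuousLinearMap.isPositive_def']
  refine ⟨hT.sub hS, fun ψ => ?_⟩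
  rw [reApplyInnerSelf_apply, inner_re_symm, _root_.sub_apply, inner_sub_right, map_sub]
  exact sub_nonneg.2 (h ψ)

theorem re_inner_le_of_clm_le {S T : H →L[ℂ] H} (h : S ≤ T) (ψ : H) :
    (⟪ψ, S ψ⟫_ℂ).re ≤ (⟪ψ, T ψ⟫_ℂ).re := by
  rw [ContinuousLinearMap.le_def, ContinuousLinearMap.isPositive_def'] at h
  have := h.2 ψ
  rw [reApplyInnerSelf_apply, inner_re_symm, _root_.sub_apply, inner_sub_right, map_sub] at this
  exact sub_nonneg.1 this

theorem nonneg_cornerHom {X : Matrix ι ι ℂ} (hX : X.IsHermitian) (h0 : ∀ x, 0 ≤ quadForm X x)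
    {C : ℝ} (hC : 0 ≤ C) : 0 ≤ cornerHom J (toEuclideanCLM (𝕜 := ℂ) X, (C : ℂ)) := by
  have h2 : IsSelfAdjoint ((C : ℝ) : ℂ) := Complex.conj_ofReal C
  have h3 : IsSelfAdjoint ((toEuclideanCLM (𝕜 := ℂ) X, (C : ℂ)) :
    (EuclideanSpace ℂ ι →L[ℂ] EuclideanSpace ℂ ι) × ℂ) :=
    Prod.ext (isSelfAdjoint_toEuclideanCLM hX) h2
  refine clm_le_of_forall_re_inner_le (.zero _) (h3.map _) fun ψ => ?_
  rw [re_inner_cornerHom]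
  have := h0 (adjoint J.toContinuousLinearMap ψ).ofLp
  simp only [_root_.zero_apply, inner_zero_right, Complex.zero_re]
  positivity

theorem cornerHom_isometry (X : Matrix ι ι ℂ) (C : ℝ) (x : EuclideanSpace ℂ ι) :
    (⟪J x, cornerHom J (toEuclideanCLM (𝕜 := ℂ) X, (C : ℂ)) (J x)⟫_ℂ).re =
      quadForm X x.ofLp := by
  rw [re_inner_cornerHom, adjoint_isometry_apply]
  simp

/-- Löwner-Heinz and compression, upper bound. -/
theorem re_inner_cfc_rpow_le {G : H →L[ℂ] H} (hG : 0 ≤ G) {X : Matrix ι ι ℂ}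
    (hX : X.IsHermitian) {C : ℝ} (hC : 0 ≤ C)
    (h : ∀ ψ, (⟪ψ, G ψ⟫_ℂ).re ≤ quadForm X (adjoint J.toContinuousLinearMap ψ).ofLp +
        C * ‖ψ - J (adjoint J.toContinuousLinearMap ψ)‖ ^ 2)
    {β : ℝ} (hβ : β ∈ Set.Icc 0 1) (x : EuclideanSpace ℂ ι) :
    (⟪J x, cfc (fun t : ℝ => t ^ β) G (J x)⟫_ℂ).re ≤ quadForm (matPow X β) x.ofLp := by
  -- On the range of `J` the term with `C` vanishes, so positivity of `G` forces that of `X`.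
  have h0 (y) : 0 ≤ quadForm X y := by
    have h1 := re_inner_le_of_clm_le hG (J (WithLp.toLp 2 y))
    have h2 := h (J (WithLp.toLp 2 y))
    rw [adjoint_isometry_apply] at h2
    simp only [_root_.zero_apply, inner_zero_right, Complex.zero_re, sub_self, norm_zero] at h1 h2
    linarith
  have hΦ := nonneg_cornerHom J hX h0 hC
  have hle : G ≤ cornerHom J (toEuclideanCLM (𝕜 := ℂ) X, (C : ℂ)) := by
    refine clm_le_of_forall_re_inner_le hG.isSelfAdjoint hΦ.isSelfAdjoint fun ψ => ?_
    rw [re_inner_cornerHom]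
    exact h ψ
  have := re_inner_le_of_clm_le (CFC.rpow_le_rpow hβ hle) (J x)
  rwa [CFC.rpow_eq_cfc_real hG, CFC.rpow_eq_cfc_real hΦ,
    cfc_cornerHom J (Real.continuous_rpow_const hβ.1) hX, cornerHom_isometry] at this

/-- Löwner-Heinz and compression, lower bound. -/
theorem le_re_inner_cfc_rpow {G : H →L[ℂ] H} (hG : 0 ≤ G) {X : Matrix ι ι ℂ}
    (hX : X.IsHermitian) (h0 : ∀ x, 0 ≤ quadForm X x)
    (h : ∀ ψ, quadForm X (adjoint J.toContinuousLinearMap ψ).ofLp ≤ (⟪ψ, G ψ⟫_ℂ).re)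
    {β : ℝ} (hβ : β ∈ Set.Icc 0 1) (x : EuclideanSpace ℂ ι) :
    quadForm (matPow X β) x.ofLp ≤ (⟪J x, cfc (fun t : ℝ => t ^ β) G (J x)⟫_ℂ).re := by
  -- For the lower bound the complement of the range of `J` receives the constant `0`.
  have hΦ := nonneg_cornerHom J hX h0 le_rfl
  have hle : cornerHom J (toEuclideanCLM (𝕜 := ℂ) X, ((0 : ℝ) : ℂ)) ≤ G := by
    refine clm_le_of_forall_re_inner_le hΦ.isSelfAdjoint hG.isSelfAdjoint fun ψ => ?_
    rw [re_inner_cornerHom]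
    simpa using h ψ
  have := re_inner_le_of_clm_le (CFC.rpow_le_rpow hβ hle) (J x)
  rwa [CFC.rpow_eq_cfc_real hG, CFC.rpow_eq_cfc_real hΦ,
    cfc_cornerHom J (Real.continuous_rpow_const hβ.1) hX, cornerHom_isometry] at this

end Compression

end LaurentIDS

end

noncomputable section

namespace LaurentIDS

/-! ### Laurent operators as multiplication operators on the circle -/

section CircleModel

open ContinuousLinearMap

open scoped InnerProductSpace ENNReal

/-- The circle `ℝ / 2πℤ`. -/
abbrev Torus : Type := AddCircle (2 * Real.pi)

instance : Fact (0 < 2 * Real.pi) := ⟨Real.two_pi_pos⟩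

/-- The Hilbert space `L²(ℝ / 2πℤ)`. -/
abbrev TorusL2 : Type := Lp ℂ 2 (AddCircle.haarAddCircle (T := 2 * Real.pi))

/-- Multiplication by a continuous function on `L²(ℝ / 2πℤ)`. -/
def mulOp (h : C(Torus, ℂ)) : TorusL2 →L[ℂ] TorusL2 :=
  (ContinuousLinearMap.mul ℂ ℂ).holderL AddCircle.haarAddCircle ∞ 2 2
    (ContinuousMap.toLp ∞ AddCircle.haarAddCircle ℂ h)

theorem coeFn_mulOp (h : C(Torus, ℂ)) (ψ : TorusL2) :
    mulOp h ψ =ᵐ[AddCircle.haarAddCircle] fun x => h x * ψ x := by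
  refine ((ContinuousLinearMap.mul ℂ ℂ).coeFn_holder
    (ContinuousMap.toLp ∞ AddCircle.haarAddCircle ℂ h) ψ).trans ?_
  filter_upwards [ContinuousMap.coeFn_toLp (p := ∞) (𝕜 := ℂ) AddCircle.haarAddCircle h] with x hx
  change (ContinuousMap.toLp ∞ AddCircle.haarAddCircle ℂ h) x * ψ x = _
  rw [hx]

/-- Multiplication operators, as a star homomorphism. -/
def mulHom : C(Torus, ℂ) →⋆ₐ[ℂ] (TorusL2 →L[ℂ] TorusL2) where
  toFun := mulOp
  map_one' := by
    ext1 ψ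
    refine Lp.ext ((coeFn_mulOp 1 ψ).trans ?_)
    simp
  map_mul' g h := by
    ext1 ψ
    refine Lp.ext ((coeFn_mulOp _ ψ).trans ?_)
    filter_upwards [coeFn_mulOp g (mulOp h ψ), coeFn_mulOp h ψ] with x h1 h2
    change _ = (mulOp g (mulOp h ψ)) x
    rw [h1, h2, ContinuousMap.mul_apply, mul_assoc]
  map_zero' := by simp [mulOp]
  map_add' g h := by simp [mulOp]
  commutes' z := by
    ext1 ψ
    refine Lp.ext ((coeFn_mulOp _ ψ).trans ?_)
    filter_upwards [Lp.coeFn_smul z ψ] with x hx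
    rw [Algebra.algebraMap_eq_smul_one, Algebra.algebraMap_eq_smul_one]
    change z * 1 * ψ x = (z • ψ) x
    rw [hx, mul_one]
    rfl
  map_star' h := by
    rw [star_eq_adjoint, eq_adjoint_iff]
    intro φ ψ
    rw [L2.inner_def, L2.inner_def]
    refine integral_congr_ae ?_
    filter_upwards [coeFn_mulOp (star h) φ, coeFn_mulOp h ψ] with x h1 h2
    rw [h1, h2]
    simp only [ContinuousMap.star_apply, RCLike.inner_apply, map_mul, Complex.star_def,
      Complex.conj_conj]
    ring

theorem continuous_mulHom : Continuous mulHom :=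
  ((ContinuousLinearMap.mul ℂ ℂ).holderL AddCircle.haarAddCircle ∞ 2 2).continuous.comp
    (ContinuousMap.toLp ∞ AddCircle.haarAddCircle ℂ).continuous

/-- With the exponent `-n`, the entry `(n, m)` of a multiplication operator is the coefficient
`a_{m-n}`, and multiplication by `e^{ikx}` reads the coordinate `n + k` at `n`, as the stencil of
`A` requires. -/
theorem orthonormal_fourier_neg :
    Orthonormal ℂ fun n : ℤ => (fourierLp 2 (-n) : TorusL2) :=
  orthonormal_fourier.comp _ neg_injective

/-- The Hilbert basis `(e^{-inx})_n` of `L²(ℝ / 2πℤ)`. -/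
def torusBasis : HilbertBasis ℤ ℂ TorusL2 :=
  HilbertBasis.mk orthonormal_fourier_neg (by
    rw [show (fun n : ℤ => (fourierLp 2 (-n) : TorusL2)) = fourierLp 2 ∘ Neg.neg from rfl,
      neg_surjective.range_comp]
    exact (span_fourierLp_closure_eq_top (by simp)).ge)

theorem torusBasis_apply (n : ℤ) : torusBasis n = fourierLp 2 (-n) :=
  congrFun (HilbertBasis.coe_mk _ _) n

theorem mulHom_fourier_torusBasis (k n : ℤ) :
    mulHom (fourier k) (torusBasis n) = torusBasis (n - k) := by
  refine Lp.ext ((coeFn_mulOp _ _).trans ?_)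
  rw [torusBasis_apply, torusBasis_apply]
  filter_upwards [coeFn_fourierLp (T := 2 * Real.pi) 2 (-n),
    coeFn_fourierLp (T := 2 * Real.pi) 2 (-(n - k))] with x h1 h2
  rw [h1, h2, ← fourier_add]
  congr 2
  ring

theorem inner_torusBasis_mulHom_fourier (k n : ℤ) (ψ : TorusL2) :
    ⟪torusBasis n, mulHom (fourier k) ψ⟫_ℂ = ⟪torusBasis (n + k), ψ⟫_ℂ := by
  rw [← adjoint_inner_left, ← star_eq_adjoint, ← map_star,
    show star (fourier k) = (fourier (-k) : C(Torus, ℂ)) from ContinuousMap.ext fun x =>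
      fourier_neg.symm, mulHom_fourier_torusBasis, sub_neg_eq_add]

theorem inner_torusBasis_mulHom_torusBasis {f : ℝ → ℝ} {F : C(Torus, ℂ)}
    (hF : ∀ x : ℝ, F x = f x) (n m : ℤ) :
    ⟪torusBasis n, mulHom F (torusBasis m)⟫_ℂ = laurent f n m := by
  have h1 : ⟪torusBasis n, mulHom F (torusBasis m)⟫_ℂ = fourierCoeff F (m - n) := by
    rw [L2.inner_def, fourierCoeff]
    refine integral_congr_ae ?_
    rw [torusBasis_apply, torusBasis_apply]
    filter_upwards [coeFn_mulOp F (fourierLp 2 (-m)), coeFn_fourierLp (T := 2 * Real.pi) 2 (-n),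
      coeFn_fourierLp (T := 2 * Real.pi) 2 (-m)] with x h1 h2 h3
    change inner ℂ _ ((mulOp F (fourierLp 2 (-m))) x) = _
    rw [h1, h2, h3, RCLike.inner_apply, ← fourier_neg, neg_neg, smul_eq_mul, neg_sub, sub_eq_add_neg,
      fourier_add]
    ring
  rw [h1, fourierCoeff_eq_intervalIntegral F _ (-Real.pi), laurent, Matrix.of_apply, symbolCoeff,
    show -Real.pi + 2 * Real.pi = Real.pi by ring, Complex.real_smul]
  congr 1
  · push_cast; rfl
  · refine intervalIntegral.integral_congr fun x _ => ?_
    rw [hF, fourier_coe_apply, smul_eq_mul, mul_comm]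
    congr 2
    push_cast
    have : (Real.pi : ℂ) ≠ 0 := Complex.ofReal_ne_zero.2 Real.pi_ne_zero
    field_simp

variable {M : ℕ} (α : ℝ) (E : Fin M → Real.Angle)

/-- The trigonometric polynomial `p(e^{ix})`. -/
def factorSymbol : C(Torus, ℂ) :=
  ∑ k ∈ Finset.range (bandN M α + 1), (factorPoly α E).coeff k • fourier (k : ℤ)

theorem natDegree_factorPoly : (factorPoly α E).natDegree = bandN M α := by
  rw [factorPoly, Polynomial.natDegree_prod_of_monic _ _
    fun i _ => (Polynomial.monic_X_sub_C _).pow _]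
  simp [Polynomial.natDegree_pow]

theorem factorSymbol_coe (x : ℝ) :
    factorSymbol α E x = (factorPoly α E).eval ((x : Real.Angle).toCircle : ℂ) := by
  rw [Polynomial.eval_eq_sum_range, natDegree_factorPoly, factorSymbol]
  simp only [ContinuousMap.sum_apply, ContinuousMap.smul_apply, smul_eq_mul]
  refine Finset.sum_congr rfl fun k _ => ?_
  rw [fourier_coe_apply, Real.Angle.toCircle_coe, Circle.coe_exp, ← Complex.exp_nat_mul]
  congr 2
  push_cast
  have : (Real.pi : ℂ) ≠ 0 := Complex.ofReal_ne_zero.2 Real.pi_ne_zero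
  field_simp

theorem star_factorSymbol_mul_coe (x : ℝ) :
    (star (factorSymbol α E) * factorSymbol α E) (x : Torus) = (symbolG α E x : ℂ) := by
  rw [ContinuousMap.mul_apply, ContinuousMap.star_apply, factorSymbol_coe, symbolG_eq,
    Complex.star_def, ← Complex.normSq_eq_conj_mul_self, Complex.normSq_eq_norm_sq]

/-- The one-sided difference operator `A`. -/
def diffOp : TorusL2 →L[ℂ] TorusL2 := mulHom (factorSymbol α E)

theorem inner_torusBasis_diffOp (n : ℤ) (ψ : TorusL2) :
    ⟪torusBasis n, diffOp α E ψ⟫_ℂ = ∑ k ∈ Finset.range (bandN M α + 1),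
      (factorPoly α E).coeff k * ⟪torusBasis (n + k), ψ⟫_ℂ := by
  rw [diffOp, factorSymbol, map_sum, sum_apply, inner_sum]
  refine Finset.sum_congr rfl fun k _ => ?_
  rw [map_smul, smul_apply, inner_smul_right, inner_torusBasis_mulHom_fourier]

theorem star_diffOp_mul : star (diffOp α E) * diffOp α E =
    mulHom (star (factorSymbol α E) * factorSymbol α E) := by
  rw [diffOp, map_mul, map_star]

theorem inner_star_diffOp_mul (n m : ℤ) :
    ⟪torusBasis n, (star (diffOp α E) * diffOp α E) (torusBasis m)⟫_ℂ =
      laurent (symbolG α E) n m := by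
  rw [star_diffOp_mul, inner_torusBasis_mulHom_torusBasis (star_factorSymbol_mul_coe α E)]

theorem isSelfAdjoint_star_factorSymbol_mul :
    IsSelfAdjoint (star (factorSymbol α E) * factorSymbol α E) := .star_mul_self _

/-- The continuous function `x ↦ f (Re h(x))`. -/
def compRe (f : ℝ → ℝ) (hf : Continuous f) (h : C(Torus, ℂ)) : C(Torus, ℂ) where
  toFun x := f (h x).re
  continuous_toFun := by fun_prop

theorem torus_continuousFunctionalCalculus :
    ContinuousFunctionalCalculus ℝ C(Torus, ℂ) IsSelfAdjoint :=
  IsSelfAdjoint.instContinuousFunctionalCalculus (A := C(Torus, ℂ))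

/-- It suffices to identify the functional calculus inside `C(Torus, ℂ)`. Evaluation at a point is
again a star homomorphism, and on a real scalar the calculus is plain application of `f`. -/
theorem cfc_starAlgHom_eq {H : Type*} [NormedAddCommGroup H] [InnerProductSpace ℂ H]
    [CompleteSpace H] (Φ : C(Torus, ℂ) →⋆ₐ[ℂ] (H →L[ℂ] H)) (hΦ : Continuous Φ)
    {f : ℝ → ℝ} (hf : Continuous f) {h : C(Torus, ℂ)} (hh : IsSelfAdjoint h) :
    cfc f (Φ h) = Φ (compRe f hf h) := by
  have := torus_continuousFunctionalCalculus
  rw [← StarAlgHomClass.map_cfc Φ f h hf.continuousOn hΦ hh (hh.map _)]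
  congr 1
  ext x
  have h1 := StarAlgHomClass.map_cfc (ContinuousMap.evalStarAlgHom ℂ ℂ x) f h hf.continuousOn
    (continuous_eval_const x) hh (hh.map _)
  have h2 : ContinuousMap.evalStarAlgHom ℂ ℂ x h = ((h x).re : ℂ) := by
    have := congrArg (fun g : C(Torus, ℂ) => g x) hh.star_eq
    exact (Complex.conj_eq_iff_re.1 this).symm
  rw [h2] at h1
  exact h1.trans (cfc_algebraMap (A := ℂ) (h x).re f)

/-- A Hilbert space model: the Laurent operators `T_g` and `T_f` in the form `A* A` and
`c (A* A)^β`, where `A` is the one-sided difference operator with coefficients `p_k`. -/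
theorem exists_laurent_model (c : ℝ) (hα : 0 < α) :
    ∃ (H : Type) (_ : NormedAddCommGroup H) (_ : InnerProductSpace ℂ H) (_ : CompleteSpace H)
      (b : HilbertBasis ℤ ℂ H) (A : H →L[ℂ] H),
      (∀ n ψ, ⟪b n, A ψ⟫_ℂ = ∑ k ∈ Finset.range (bandN M α + 1),
        (factorPoly α E).coeff k * ⟪b (n + k), ψ⟫_ℂ) ∧
      (∀ n m, ⟪b n, (star A * A) (b m)⟫_ℂ = laurent (symbolG α E) n m) ∧
      (∀ n m, c * ⟪b n, cfc (fun t : ℝ => t ^ (α / alphaBar α)) (star A * A) (b m)⟫_ℂ =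
        laurent (symbolF c α E) n m) := by
  refine ⟨TorusL2, inferInstance, inferInstance, inferInstance, torusBasis, diffOp α E,
    inner_torusBasis_diffOp α E, inner_star_diffOp_mul α E, fun n m => ?_⟩
  have hβ : 0 ≤ α / alphaBar α := by positivity
  have hcont := Real.continuous_rpow_const hβ
  have hsa := isSelfAdjoint_star_factorSymbol_mul α E
  have key := cfc_starAlgHom_eq mulHom continuous_mulHom hcont hsa
  rw [star_diffOp_mul]
  refine (congrArg (fun T : TorusL2 →L[ℂ] TorusL2 => (c : ℂ) * ⟪torusBasis n, T (torusBasis m)⟫_ℂ)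
    key).trans ?_
  rw [← inner_torusBasis_mulHom_torusBasis (F := (c : ℂ) •
      compRe _ hcont (star (factorSymbol α E) * factorSymbol α E)),
    map_smul, smul_apply, inner_smul_right]
  intro x
  change (c : ℂ) * ((((star (factorSymbol α E) * factorSymbol α E) (x : Torus)).re ^
    (α / alphaBar α) : ℝ) : ℂ) = _
  rw [star_factorSymbol_mul_coe, symbolF_eq c hα]
  simp

end CircleModel

end LaurentIDS

end

noncomputable section

namespace LaurentIDS

/-! ### The corrected box matrices as weighted sums over the rows of `A` -/

section BoxForm

open Polynomial in
/-- A polynomial is self-reciprocal up to a phase if its coefficients satisfy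
`conj p_{N-k} = γ p_k`, where `N` is the degree and `|γ| = 1`. -/
def IsSelfReciprocal (p : ℂ[X]) : Prop :=
  ∃ γ : ℂ, ‖γ‖ = 1 ∧ (p.map (starRingEnd ℂ)).reverse = C γ * p

open Polynomial in
theorem IsSelfReciprocal.mul {p q : ℂ[X]} (hp : IsSelfReciprocal p) (hq : IsSelfReciprocal q) :
    IsSelfReciprocal (p * q) := by
  obtain ⟨γ, h1, h2⟩ := hp
  obtain ⟨δ, h3, h4⟩ := hq
  refine ⟨γ * δ, by simp [h1, h3], ?_⟩
  rw [Polynomial.map_mul, reverse_mul_of_domain, h2, h4, C_mul]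
  ring

open Polynomial in
theorem isSelfReciprocal_one : IsSelfReciprocal 1 :=
  ⟨1, by simp, by rw [Polynomial.map_one, ← C_1, reverse_C]; simp⟩

-- For `|a| = 1`, the reversal of `X - ā` is `1 - ā X = -ā (X - a)`, so the phase is `-ā`.
open Polynomial in
theorem isSelfReciprocal_X_sub_C (a : Circle) : IsSelfReciprocal (X - C (a : ℂ)) := by
  refine ⟨-(starRingEnd ℂ) a, by simp [Circle.norm_coe], ?_⟩
  have h1 : (X : ℂ[X]).reverse = 1 := by
    rw [← mul_one (X : ℂ[X]), reverse_X_mul, ← C_1, reverse_C]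
  rw [Polynomial.map_sub, map_X, map_C, sub_eq_add_neg, ← C_neg, reverse_add_C, h1, natDegree_X,
    pow_one, mul_sub, ← C_mul, neg_mul, ← Complex.normSq_eq_conj_mul_self, Circle.normSq_coe]
  simp
  ring

theorem IsSelfReciprocal.prod {ι : Type*} (s : Finset ι) (p : ι → Polynomial ℂ)
    (h : ∀ i ∈ s, IsSelfReciprocal (p i)) : IsSelfReciprocal (∏ i ∈ s, p i) :=
  Finset.prod_induction _ _ (fun _ _ => .mul) isSelfReciprocal_one h

theorem IsSelfReciprocal.pow {p : Polynomial ℂ} (h : IsSelfReciprocal p) (n : ℕ) :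
    IsSelfReciprocal (p ^ n) := by
  simpa using IsSelfReciprocal.prod (Finset.range n) (fun _ => p) fun _ _ => h

variable {M : ℕ} (α : ℝ) (E : Fin M → Real.Angle)

/-- The coefficients `p_k`, extended by zero to `k ∈ ℤ`. -/
def coeffZ (j : ℤ) : ℂ := if 0 ≤ j then (factorPoly α E).coeff j.toNat else 0

theorem coeffZ_natCast (j : ℕ) : coeffZ α E j = (factorPoly α E).coeff j := by
  simp [coeffZ]

theorem coeffZ_of_neg {j : ℤ} (h : j < 0) : coeffZ α E j = 0 := if_neg (by omega)

theorem coeffZ_of_gt {j : ℤ} (h : (bandN M α : ℤ) < j) : coeffZ α E j = 0 := by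
  rw [coeffZ]
  split_ifs
  · refine Polynomial.coeff_eq_zero_of_natDegree_lt ?_
    rw [natDegree_factorPoly]
    omega
  · rfl

theorem exists_star_coeffZ : ∃ γ : ℂ, ‖γ‖ = 1 ∧
    ∀ j, star (coeffZ α E (bandN M α - j)) = γ * coeffZ α E j := by
  obtain ⟨γ, h1, h2⟩ : IsSelfReciprocal (factorPoly α E) :=
    .prod _ _ fun i _ => (isSelfReciprocal_X_sub_C _).pow _
  refine ⟨γ, h1, fun j => ?_⟩
  rcases lt_or_ge j 0 with h | h
  · rw [coeffZ_of_neg α E h, coeffZ_of_gt α E (by omega)]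
    simp
  rcases lt_or_ge (bandN M α : ℤ) j with h' | h'
  · rw [coeffZ_of_neg α E (by omega), coeffZ_of_gt α E h']
    simp
  lift j to ℕ using h
  have h3 := congrArg (fun q => Polynomial.coeff q j) h2
  simp only [Polynomial.coeff_C_mul] at h3
  have hj : j ≤ bandN M α := by exact_mod_cast h'
  rw [Polynomial.coeff_reverse, Polynomial.natDegree_map, natDegree_factorPoly,
    Polynomial.revAt_le hj, Polynomial.coeff_map] at h3
  rw [coeffZ_natCast, ← h3, ← Nat.cast_sub hj, coeffZ_natCast]
  rfl

/-- The phase `γ` occurs together with its conjugate and cancels. This symmetry is why the block for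
the right endpoint is the anti-diagonal reflection of the one for the left endpoint. -/
theorem star_coeffZ_mul_coeffZ (i j : ℤ) :
    star (coeffZ α E (bandN M α - i)) * coeffZ α E (bandN M α - j) =
      star (coeffZ α E j) * coeffZ α E i := by
  obtain ⟨γ, h1, h2⟩ := exists_star_coeffZ α E
  have h3 := congrArg star (h2 j)
  rw [star_star] at h3
  rw [h2, h3, star_mul, mul_mul_mul_comm]
  have : γ * star γ = 1 := by
    rw [Complex.star_def, Complex.mul_conj, Complex.normSq_eq_norm_sq, h1]
    simp
  calc _ = star (coeffZ α E j) * (γ * star γ) * coeffZ α E i := by ring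
    _ = _ := by rw [this, mul_one]

/-- The row `r` of the difference operator, applied to a sequence: `∑_{k ≤ N} p_k u(r + k)`. -/
def diffRow (u : ℤ → ℂ) (r : ℤ) : ℂ :=
  ∑ k ∈ Finset.range (bandN M α + 1), (factorPoly α E).coeff k * u (r + k)

/-- The row `r` of the difference operator, applied to a vector on a box. -/
def boxRow {L : ℕ} (x : Box L → ℂ) (r : ℤ) : ℂ := ∑ m : Box L, coeffZ α E (m - r) * x m

theorem boxRow_eq_zero {L : ℕ} (x : Box L → ℂ) {r : ℤ}
    (h : r ∉ Finset.Icc (-(L : ℤ) - bandN M α) L) : boxRow α E x r = 0 := by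
  refine Finset.sum_eq_zero fun m _ => ?_
  have hm := Finset.mem_Icc.1 m.2
  rw [Finset.mem_Icc, not_and_or, not_le, not_le] at h
  rcases h with h | h
  · rw [coeffZ_of_gt α E (by omega), zero_mul]
  · rw [coeffZ_of_neg α E (by omega), zero_mul]

/-- Extension by zero of a vector on a box. -/
def boxExt {L : ℕ} (x : Box L → ℂ) (n : ℤ) : ℂ :=
  if h : n ∈ Finset.Icc (-(L : ℤ)) (L : ℤ) then x ⟨n, h⟩ else 0

theorem boxExt_apply {L : ℕ} (x : Box L → ℂ) (m : Box L) : boxExt x m = x m := by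
  rw [boxExt, dif_pos m.2]

theorem boxExt_of_notMem {L : ℕ} (x : Box L → ℂ) {n : ℤ}
    (h : n ∉ Finset.Icc (-(L : ℤ)) (L : ℤ)) : boxExt x n = 0 := dif_neg h

theorem diffRow_boxExt {L : ℕ} (x : Box L → ℂ) (r : ℤ) :
    diffRow α E (boxExt x) r = boxRow α E x r := by
  have h1 : boxRow α E x r = ∑ m ∈ Finset.Icc (-(L : ℤ)) L, coeffZ α E (m - r) * boxExt x m := by
    rw [boxRow, ← Finset.sum_coe_sort (Finset.Icc (-(L : ℤ)) L)]
    exact Finset.sum_congr rfl fun m _ => by rw [boxExt_apply]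
  have h2 : diffRow α E (boxExt x) r =
      ∑ m ∈ (Finset.range (bandN M α + 1)).image (fun k : ℕ => r + k),
        coeffZ α E (m - r) * boxExt x m := by
    rw [Finset.sum_image (by intro a _ b _ h; simpa using h)]
    exact Finset.sum_congr rfl fun k _ => by
      rw [add_sub_cancel_left, coeffZ_natCast]
  rw [h1, h2, Finset.sum_subset (Finset.subset_union_left (s₂ := Finset.Icc (-(L : ℤ)) L)),
    ← Finset.sum_subset (Finset.subset_union_right
      (s₁ := (Finset.range (bandN M α + 1)).image (fun k : ℕ => r + k)))]
  · intro m _ hm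
    rw [boxExt_of_notMem x hm, mul_zero]
  · intro m _ hm
    rcases lt_or_ge (m - r) 0 with h | h
    · rw [coeffZ_of_neg α E h, zero_mul]
    rw [coeffZ_of_gt α E, zero_mul]
    by_contra h'
    refine hm (Finset.mem_image.2 ⟨(m - r).toNat, ?_, ?_⟩)
    · rw [Finset.mem_range]; omega
    · omega

open Matrix in
theorem quadForm_of_eq_sum_star_mul {ι κ : Type*} [Fintype ι] (s : Finset κ) (R : κ → ι → ℂ)
    {A : Matrix ι ι ℂ} (hA : ∀ n m, A n m = ∑ r ∈ s, star (R r n) * R r m) (x : ι → ℂ) :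
    quadForm A x = ∑ r ∈ s, ‖∑ m, R r m * x m‖ ^ 2 := by
  have h : star x ⬝ᵥ A *ᵥ x = ∑ r ∈ s, star (∑ m, R r m * x m) * ∑ m, R r m * x m := by
    simp only [dotProduct, mulVec, hA, star_sum, Finset.sum_mul, Finset.mul_sum, Pi.star_apply,
      star_mul']
    rw [Finset.sum_comm, Finset.sum_congr rfl fun m _ => Finset.sum_comm, Finset.sum_comm]
    refine Finset.sum_congr rfl fun r _ => Finset.sum_congr rfl fun m _ =>
      Finset.sum_congr rfl fun n _ => ?_
    ring
  rw [quadForm, h, Complex.re_sum]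
  refine Finset.sum_congr rfl fun r _ => ?_
  rw [Complex.star_def, ← Complex.normSq_eq_conj_mul_self, Complex.normSq_eq_norm_sq,
    Complex.ofReal_re]

open Matrix

/-- The rows `-L - 1 - s`, `s < N`, are those that can straddle the left endpoint. At sites beyond
the first `N` of the box their coefficients vanish by degree, so one formula covers the block and
the zeros around it. -/
theorem leftCorner_bcD_apply {L : ℕ} (n m : Box L) :
    leftCorner L (bcD α E) n m = ∑ s ∈ Finset.range (bandN M α),
      star (coeffZ α E (n - (-L - 1 - s))) * coeffZ α E (m - (-L - 1 - s)) := by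
  have hn := Finset.mem_Icc.1 n.2
  have hm := Finset.mem_Icc.1 m.2
  rw [leftCorner, of_apply]
  by_cases h : (n : ℤ) < -L + bandN M α ∧ (m : ℤ) < -L + bandN M α
  · have hi : ((n : ℤ) + L).toNat < bandN M α := by omega
    have hj : ((m : ℤ) + L).toNat < bandN M α := by omega
    rw [Finset.sum_eq_single ⟨_, hi⟩, Finset.sum_eq_single ⟨_, hj⟩, if_pos, bcD, mul_apply,
      Finset.sum_range]
    · refine Finset.sum_congr rfl fun s _ => ?_
      rw [conjTranspose_apply, straddle, of_apply, of_apply, ← coeffZ_natCast, ← coeffZ_natCast]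
      congr 3 <;> push_cast <;> omega
    · constructor <;> simp <;> omega
    · intro j _ hj'
      refine if_neg fun h' => hj' (Fin.ext ?_)
      simp only
      omega
    · simp
    · intro i _ hi'
      refine Finset.sum_eq_zero fun j _ => if_neg fun h' => hi' (Fin.ext ?_)
      simp only
      omega
    · simp
  · rw [Finset.sum_eq_zero, Finset.sum_eq_zero]
    · intro s hs
      rw [not_and_or] at h
      rcases h with h | h
      · rw [coeffZ_of_gt α E (by omega), star_zero, zero_mul]
      · rw [coeffZ_of_gt α E (j := m - (-L - 1 - s)) (by omega), mul_zero]
    · intro i _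
      refine Finset.sum_eq_zero fun j _ => if_neg fun h' => h ?_
      have := i.2
      have := j.2
      omega

theorem rightCorner_bcD_apply {L : ℕ} (n m : Box L) :
    rightCorner L (antiReflect (bcD α E)) n m = ∑ s ∈ Finset.range (bandN M α),
      star (coeffZ α E (n - (L - bandN M α + 1 + s))) *
        coeffZ α E (m - (L - bandN M α + 1 + s)) := by
  have hn := Finset.mem_Icc.1 n.2
  have hm := Finset.mem_Icc.1 m.2
  rw [rightCorner, of_apply, ← Equiv.sum_comp Fin.revPerm]
  rw [Finset.sum_congr rfl fun i _ => (Equiv.sum_comp Fin.revPerm _).symm]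
  simp only [Fin.revPerm_apply, Fin.rev_rev, antiReflect, of_apply]
  by_cases h : (L : ℤ) - bandN M α < n ∧ (L : ℤ) - bandN M α < m
  · have hi : ((L : ℤ) - n).toNat < bandN M α := by omega
    have hj : ((L : ℤ) - m).toNat < bandN M α := by omega
    rw [Finset.sum_eq_single ⟨_, hi⟩, Finset.sum_eq_single ⟨_, hj⟩, if_pos, bcD, mul_apply,
      Finset.sum_range]
    · refine Finset.sum_congr rfl fun s _ => ?_
      rw [conjTranspose_apply, straddle, of_apply, of_apply, ← coeffZ_natCast, ← coeffZ_natCast]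
      -- The reflected block contains the coefficients in reversed order; self-reciprocity brings
      -- them back to the rows `L - N + 1 + s` that straddle the right endpoint.
      refine (star_coeffZ_mul_coeffZ α E _ _).symm.trans ?_
      refine congrArg₂ (· * ·) (congrArg (fun j => star (coeffZ α E j)) ?_)
        (congrArg (coeffZ α E) ?_) <;> simp only [Nat.cast_add, Nat.cast_one] <;> omega
    · constructor <;> simp <;> omega
    · intro j _ hj'
      refine if_neg fun h' => hj' (Fin.ext ?_)
      simp only
      omega
    · simp
    · intro i _ hi'
      refine Finset.sum_eq_zero fun j _ => if_neg fun h' => hi' (Fin.ext ?_)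
      simp only
      omega
    · simp
  · rw [Finset.sum_eq_zero, Finset.sum_eq_zero]
    · intro s hs
      rw [not_and_or] at h
      rcases h with h | h
      · rw [coeffZ_of_neg α E (by omega), star_zero, zero_mul]
      · rw [coeffZ_of_neg α E (j := m - (L - bandN M α + 1 + s)) (by omega), mul_zero]
    · intro i _
      refine Finset.sum_eq_zero fun j _ => if_neg fun h' => h ?_
      have := i.2
      have := j.2
      omega

theorem inner_torusBasis_diffOp_torusBasis (r m : ℤ) :
    inner ℂ (torusBasis r) (diffOp α E (torusBasis m)) = coeffZ α E (m - r) := by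
  rw [inner_torusBasis_diffOp]
  have h (k : ℤ) : inner ℂ (torusBasis k) (torusBasis m) = if k = m then (1 : ℂ) else 0 :=
    orthonormal_iff_ite.1 torusBasis.orthonormal k m
  simp only [h, mul_ite, mul_one, mul_zero]
  rcases lt_or_ge (m - r) 0 with h0 | h0
  · rw [coeffZ_of_neg α E h0, Finset.sum_eq_zero]
    intro k _
    rw [if_neg (by omega)]
  obtain ⟨j, hj⟩ := Int.eq_ofNat_of_zero_le h0
  rw [hj, coeffZ_natCast]
  by_cases hjN : j ∈ Finset.range (bandN M α + 1)
  · rw [Finset.sum_eq_single_of_mem j hjN, if_pos (by omega)]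
    intro k _ hk
    rw [if_neg (by omega)]
  · rw [← coeffZ_natCast, coeffZ_of_gt α E (by simp at hjN; omega), Finset.sum_eq_zero]
    intro k hk
    rw [if_neg]
    rintro h'
    refine hjN ?_
    rwa [show j = k by omega]

/-- Parseval for the inner product of `A b_n` and `A b_m`. Only rows in `[-L - N, L]` reach the box,
so the same finite range serves all entries. -/
theorem laurent_symbolG_apply {L : ℕ} (n m : Box L) :
    laurent (symbolG α E) n m = ∑ r ∈ Finset.Icc (-(L : ℤ) - bandN M α) L,
      star (coeffZ α E (n - r)) * coeffZ α E (m - r) := by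
  have hn := Finset.mem_Icc.1 n.2
  have h1 := torusBasis.hasSum_inner_mul_inner (diffOp α E (torusBasis n))
    (diffOp α E (torusBasis m))
  rw [← inner_star_diffOp_mul, mul_apply_eq_comp, ContinuousLinearMap.star_eq_adjoint,
    ContinuousLinearMap.adjoint_inner_right]
  refine h1.unique ?_
  have h2 : ∀ r : ℤ, inner ℂ (diffOp α E (torusBasis n)) (torusBasis r) *
      inner ℂ (torusBasis r) (diffOp α E (torusBasis m)) =
      star (coeffZ α E (n - r)) * coeffZ α E (m - r) := fun r => by
    rw [← inner_conj_symm, inner_torusBasis_diffOp_torusBasis, inner_torusBasis_diffOp_torusBasis]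
    rfl
  simp only [h2]
  refine hasSum_sum_of_ne_finset_zero fun r hr => ?_
  rw [Finset.mem_Icc, not_and_or, not_le, not_le] at hr
  rcases hr with h | h
  · rw [coeffZ_of_gt α E (by omega), star_zero, zero_mul]
  · rw [coeffZ_of_neg α E (by omega), star_zero, zero_mul]

/-- The weight of the row `r` in the form of `T_{g,Λ} + ε diag(B_D, 0, B̃_D)`. -/
def rowWeight (ε : ℝ) (L N : ℕ) (r : ℤ) : ℝ :=
  1 + ε * ((if r < -L then 1 else 0) + (if (L : ℤ) < r + N then 1 else 0))

/-- Both corner blocks are Gram matrices of rows of `A` cut to the box, so the corrections only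
change the weights of straddling rows. Rows too far away to straddle also receive a changed weight,
but they vanish on the box. The sum runs over all of `ℤ` so that it can be compared termwise with
Parseval for `A ψ`. -/
theorem quadForm_withBC (ε : ℝ) (L : ℕ) (x : Box L → ℂ) :
    HasSum (fun r : ℤ => rowWeight ε L (bandN M α) r * ‖boxRow α E x r‖ ^ 2)
      (quadForm (withBC L (laurent (symbolG α E)) ((ε : ℂ) • bcD α E)) x) := by
  have h0 : withBC L (laurent (symbolG α E)) ((ε : ℂ) • bcD α E) =
      restrict L (laurent (symbolG α E)) + (ε : ℂ) • (leftCorner L (bcD α E) +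
        rightCorner L (antiReflect (bcD α E))) := by
    rw [withBC, add_assoc]
    congr 1
    ext n m
    simp only [leftCorner, rightCorner, antiReflect, Matrix.add_apply, Matrix.smul_apply, of_apply, smul_add,
      Finset.smul_sum, smul_ite, smul_zero]
  have hz : ∀ r ∉ Finset.Icc (-(L : ℤ) - bandN M α) L, ‖boxRow α E x r‖ ^ 2 = 0 := fun r hr => by
    rw [boxRow_eq_zero α E x hr]; simp
  rw [h0, quadForm_add, quadForm_smul, quadForm_add,
    quadForm_of_eq_sum_star_mul (A := restrict L (laurent (symbolG α E))) _
      (fun r (m : Box L) => coeffZ α E (m - r)) (laurent_symbolG_apply α E) x,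
    quadForm_of_eq_sum_star_mul _ (fun (s : ℕ) (m : Box L) => coeffZ α E (m - (-L - 1 - s)))
      (leftCorner_bcD_apply α E) x,
    quadForm_of_eq_sum_star_mul _
      (fun (s : ℕ) (m : Box L) => coeffZ α E (m - (L - bandN M α + 1 + s)))
      (rightCorner_bcD_apply α E) x]
  simp only [rowWeight, add_mul, one_mul, mul_assoc, mul_add]
  refine (hasSum_sum_of_ne_finset_zero hz).add (.add (.mul_left _ ?_) (.mul_left _ ?_))
  · have := hasSum_sum_of_ne_finset_zero (L := .unconditional ℤ)
      (f := fun r : ℤ => (if r < -L then (1 : ℝ) else 0) * ‖boxRow α E x r‖ ^ 2)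
      (s := (Finset.range (bandN M α)).image fun s : ℕ => -(L : ℤ) - 1 - s) ?_
    · rw [Finset.sum_image (by intro a _ b _ h; simpa using h)] at this
      refine Eq.subst (motive := fun z => HasSum _ z) ?_ this
      refine Finset.sum_congr rfl fun s _ => ?_
      rw [if_pos (by omega), one_mul]
      rfl
    · intro r hr
      split_ifs with h
      · rw [hz, mul_zero]
        intro h'
        rw [Finset.mem_Icc] at h'
        refine hr (Finset.mem_image.2 ⟨(-L - 1 - r).toNat, ?_, ?_⟩)
        · rw [Finset.mem_range]; omega
        · omega
      · rw [zero_mul]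
  · have := hasSum_sum_of_ne_finset_zero (L := .unconditional ℤ)
      (f := fun r : ℤ => (if (L : ℤ) < r + bandN M α then (1 : ℝ) else 0) *
        ‖boxRow α E x r‖ ^ 2)
      (s := (Finset.range (bandN M α)).image fun s : ℕ => (L : ℤ) - bandN M α + 1 + s) ?_
    · rw [Finset.sum_image (by intro a _ b _ h; simpa using h)] at this
      refine Eq.subst (motive := fun z => HasSum _ z) ?_ this
      refine Finset.sum_congr rfl fun s _ => ?_
      rw [if_pos (by omega), one_mul]
      rfl
    · intro r hr
      split_ifs with h
      · rw [hz, mul_zero]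
        intro h'
        rw [Finset.mem_Icc] at h'
        refine hr (Finset.mem_image.2 ⟨(r - (L - bandN M α + 1)).toNat, ?_, ?_⟩)
        · rw [Finset.mem_range]; omega
        · omega
      · rw [zero_mul]

theorem dirichlet_eq (L : ℕ) : dirichlet α E L =
    withBC L (laurent (symbolG α E)) (((1 : ℝ) : ℂ) • bcD α E) := by
  simp [dirichlet]

theorem neumann_eq (L : ℕ) : neumann α E L =
    withBC L (laurent (symbolG α E)) (((-1 : ℝ) : ℂ) • bcD α E) := by
  simp [neumann, bcN]

end BoxForm

end LaurentIDS

end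

noncomputable section

namespace LaurentIDS

/-! ### Row by row comparison of the lattice with its tiles -/

section Tiles

open Matrix

open scoped InnerProductSpace

theorem quadForm_blockDiagonal {ι κ : Type*} [Fintype ι] [Fintype κ] [DecidableEq κ]
    (X : κ → Matrix ι ι ℂ) (x : ι × κ → ℂ) :
    quadForm (blockDiagonal X) x = ∑ t, quadForm (X t) fun j => x (j, t) := by
  simp only [quadForm, dotProduct, mulVec, Fintype.sum_prod_type_right, blockDiagonal_apply,
    Complex.re_sum, Pi.star_apply, ite_mul, zero_mul, Finset.sum_ite_irrel, Finset.sum_const_zero,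
    Finset.sum_ite_eq, Finset.mem_univ, if_true]

/-- Cauchy-Schwarz on `{a, b}`, where `a = b` is allowed. The constant `2` is the Dirichlet weight
of a row that straddles one endpoint. -/
theorem norm_sum_sq_le_two_mul {κ : Type*} [Fintype κ] (z : κ → ℂ) (a b : κ)
    (h : ∀ i, i ≠ a → i ≠ b → z i = 0) : ‖∑ i, z i‖ ^ 2 ≤ 2 * ∑ i, ‖z i‖ ^ 2 := by
  classical
  have h1 : ∑ i, z i = ∑ i ∈ {a, b}, z i :=
    (Finset.sum_subset (Finset.subset_univ _) fun i _ hi => by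
      simp only [Finset.mem_insert, Finset.mem_singleton, not_or] at hi
      exact h i hi.1 hi.2).symm
  calc ‖∑ i, z i‖ ^ 2 ≤ (∑ i ∈ {a, b}, ‖z i‖) ^ 2 := by
        rw [h1]
        gcongr
        exact norm_sum_le _ _
    _ ≤ (({a, b} : Finset κ).card : ℝ) * ∑ i ∈ {a, b}, ‖z i‖ ^ 2 := sq_sum_le_card_mul_sum_sq
    _ ≤ 2 * ∑ i ∈ {a, b}, ‖z i‖ ^ 2 := by
        gcongr
        exact_mod_cast Finset.card_le_two
    _ ≤ 2 * ∑ i, ‖z i‖ ^ 2 := by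
        gcongr
        exact Finset.subset_univ _

/-- The index of the translate of `Λ_L` by multiples of `2 L + 1` that contains a site. -/
def tileOf (L : ℕ) (n : ℤ) : ℤ := (n + L) / (2 * L + 1)

theorem tileOf_eq_iff (L : ℕ) (n t : ℤ) :
    tileOf L n = t ↔ -(L : ℤ) ≤ n - t * (2 * L + 1) ∧ n - t * (2 * L + 1) ≤ L := by
  have hW : (0 : ℤ) < 2 * L + 1 := by omega
  have h1 := Int.le_ediv_iff_mul_le (a := t) (b := n + L) hW
  have h2 := Int.ediv_lt_iff_lt_mul (a := n + L) (b := t + 1) hW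
  rw [add_mul] at h2
  rw [tileOf]
  constructor
  · rintro h
    have h3 := h1.1 h.ge
    have h4 := h2.1 (by omega)
    constructor <;> linarith
  · rintro ⟨h3, h4⟩
    have h5 := h1.2 (by linarith)
    have h6 := h2.2 (by linarith)
    omega

theorem tileOf_mono (L : ℕ) : Monotone (tileOf L) := fun _ _ h =>
  Int.ediv_le_ediv (by omega) (by omega)

/-- A stencil spans at most one tile length, so the tile index rises by at most one along it. -/
theorem tileOf_add_eq_or {L N : ℕ} (hN : N ≤ 2 * L + 1) (r : ℤ) {k : ℕ} (hk : k ≤ N) :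
    tileOf L (r + k) = tileOf L r ∨ tileOf L (r + k) = tileOf L (r + N) := by
  have h1 := tileOf_mono L (show r ≤ r + k by omega)
  have h2 := tileOf_mono L (show r + k ≤ r + N by omega)
  have h3 := tileOf_mono L (show r + N ≤ r + (2 * L + 1) by omega)
  have h4 : tileOf L (r + (2 * L + 1)) = tileOf L r + 1 := by
    rw [tileOf, tileOf, show r + (2 * L + 1) + (L : ℤ) = r + L + (2 * L + 1) by ring,
      Int.add_ediv_of_dvd_right dvd_rfl, Int.ediv_self (by omega)]
  omega

/-- The part of a sequence in the tile `t`. -/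
def tilePart (L : ℕ) (u : ℤ → ℂ) (t n : ℤ) : ℂ := if tileOf L n = t then u n else 0

/-- The part of a sequence outside the tiles `-n, …, n`. -/
def restPart (L n : ℕ) (u : ℤ → ℂ) (m : ℤ) : ℂ :=
  if tileOf L m ∈ Finset.Icc (-(n : ℤ)) n then 0 else u m

theorem restPart_add_sum_tilePart (L n : ℕ) (u : ℤ → ℂ) (m : ℤ) :
    restPart L n u m + ∑ t : Box n, tilePart L u t m = u m := by
  simp only [restPart, tilePart]
  rw [Finset.sum_coe_sort (Finset.Icc (-(n : ℤ)) n) (fun t => if tileOf L m = t then u m else 0),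
    Finset.sum_ite_eq]
  split_ifs <;> simp

variable {M : ℕ} (α : ℝ) (E : Fin M → Real.Angle)

theorem diffRow_tilePart (L : ℕ) (u : ℤ → ℂ) (t r : ℤ) :
    diffRow α E (tilePart L u t) r =
      boxRow α E (fun j : Box L => u (t * (2 * L + 1) + j)) (r - t * (2 * L + 1)) := by
  rw [← diffRow_boxExt]
  refine Finset.sum_congr rfl fun k _ => ?_
  congr 1
  rw [tilePart, boxExt]
  by_cases h : tileOf L (r + k) = t
  · rw [if_pos h, dif_pos]
    · congr 1
      ring
    · rw [tileOf_eq_iff] at h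
      rw [Finset.mem_Icc]
      constructor <;> linarith [h.1, h.2]
  · rw [if_neg h, dif_neg]
    rw [tileOf_eq_iff] at h
    rw [Finset.mem_Icc]
    rintro ⟨h1, h2⟩
    exact h ⟨by linarith, by linarith⟩

theorem diffRow_congr {u v : ℤ → ℂ} {r : ℤ} (h : ∀ k : ℕ, k ≤ bandN M α → u (r + k) = v (r + k)) :
    diffRow α E u r = diffRow α E v r :=
  Finset.sum_congr rfl fun k hk => by rw [h k (Nat.lt_succ_iff.1 (Finset.mem_range.1 hk))]

theorem diffRow_eq_zero {u : ℤ → ℂ} {r : ℤ} (h : ∀ k : ℕ, k ≤ bandN M α → u (r + k) = 0) :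
    diffRow α E u r = 0 :=
  Finset.sum_eq_zero fun k hk => by
    rw [h k (Nat.lt_succ_iff.1 (Finset.mem_range.1 hk)), mul_zero]

theorem diffRow_eq_rest_add_sum (L n : ℕ) (u : ℤ → ℂ) (r : ℤ) :
    diffRow α E u r = diffRow α E (restPart L n u) r +
      ∑ t : Box n, diffRow α E (tilePart L u t) r := by
  simp only [diffRow]
  rw [Finset.sum_comm, ← Finset.sum_add_distrib]
  refine Finset.sum_congr rfl fun k _ => ?_
  rw [← Finset.mul_sum, ← mul_add, restPart_add_sum_tilePart]

/-- The stencil `{r, …, r + N}` lies in the tile `t`. -/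
def IsInterior (L N : ℕ) (t r : ℤ) : Prop :=
  -(L : ℤ) ≤ r - t * (2 * L + 1) ∧ r - t * (2 * L + 1) + N ≤ L

theorem IsInterior.tileOf_eq {L N : ℕ} {t r : ℤ} (h : IsInterior L N t r) {k : ℕ} (hk : k ≤ N) :
    tileOf L (r + k) = t := by
  have hk' : (k : ℤ) ≤ N := by exact_mod_cast hk
  have hk0 : (0 : ℤ) ≤ k := by positivity
  exact (tileOf_eq_iff _ _ _).2 ⟨by linarith [h.1], by linarith [h.2]⟩

theorem IsInterior.rowWeight {L N : ℕ} {t r : ℤ} (h : IsInterior L N t r) (ε : ℝ) :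
    rowWeight ε L N (r - t * (2 * L + 1)) = 1 := by
  rw [LaurentIDS.rowWeight, if_neg (not_lt.2 h.1), if_neg (not_lt.2 h.2)]
  simp

/-- Every row not interior to the tile is covered, including those that miss it; the latter
contribute zero, so no finer case distinction is needed. -/
theorem one_le_of_not_isInterior {L N : ℕ} {t r : ℤ} (h : ¬ IsInterior L N t r) :
    (1 : ℝ) ≤ (if r - t * (2 * L + 1) < -L then 1 else 0) +
      (if (L : ℤ) < r - t * (2 * L + 1) + N then 1 else 0) := by
  rw [IsInterior, not_and_or, not_le, not_le] at h
  rcases h with h | h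
  · rw [if_pos h]
    split_ifs <;> norm_num
  · rw [if_pos h]
    split_ifs <;> norm_num

theorem IsInterior.diffRow_eq {L : ℕ} {t r : ℤ} (h : IsInterior L (bandN M α) t r) (u : ℤ → ℂ) :
    diffRow α E (tilePart L u t) r = diffRow α E u r :=
  diffRow_congr α E fun k hk => by rw [tilePart, if_pos (h.tileOf_eq hk)]

theorem IsInterior.diffRow_eq_zero {L : ℕ} {t s r : ℤ} (h : IsInterior L (bandN M α) t r)
    (hs : s ≠ t) (u : ℤ → ℂ) : diffRow α E (tilePart L u s) r = 0 :=
  LaurentIDS.diffRow_eq_zero α E fun k hk => by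
    rw [tilePart, if_neg (by rw [h.tileOf_eq hk]; exact hs.symm)]

theorem rowWeight_one_nonneg (L N : ℕ) (r : ℤ) : 0 ≤ rowWeight 1 L N r := by
  rw [rowWeight]
  split_ifs <;> norm_num

-- A row interior to one of the tiles is bounded by the term of that tile. Otherwise at most two of
-- the pieces (the tiles and the rest) meet the stencil, and the resulting factor `2` is at most the
-- weight in every tile.
open scoped Classical in
theorem norm_diffRow_sq_le {L : ℕ} (hL : bandN M α ≤ 2 * L + 1) (n : ℕ) (u : ℤ → ℂ) (r : ℤ) :
    ‖diffRow α E u r‖ ^ 2 ≤ 2 * ‖diffRow α E (restPart L n u) r‖ ^ 2 +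
      ∑ t : Box n, rowWeight 1 L (bandN M α) (r - t * (2 * L + 1)) *
        ‖diffRow α E (tilePart L u t) r‖ ^ 2 := by
  by_cases hint : ∃ t : Box n, IsInterior L (bandN M α) t r
  · obtain ⟨t, ht⟩ := hint
    have h1 := Finset.single_le_sum (f := fun t : Box n =>
      rowWeight 1 L (bandN M α) (r - t * (2 * L + 1)) *
        ‖diffRow α E (tilePart L u t) r‖ ^ 2)
      (fun t _ => mul_nonneg (rowWeight_one_nonneg _ _ _) (sq_nonneg _)) (Finset.mem_univ t)
    simp only [ht.rowWeight, ht.diffRow_eq, one_mul] at h1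
    have h2 := sq_nonneg ‖diffRow α E (restPart L n u) r‖
    linarith
  rw [not_exists] at hint
  -- The label of the piece containing a site, with `none` for the rest. By monotonicity of the tile
  -- index, the labels of the two ends of the stencil are the only ones that occur.
  let lab : ℤ → Option (Box n) := fun m =>
    if h : tileOf L m ∈ Finset.Icc (-(n : ℤ)) n then some ⟨_, h⟩ else none
  have hlab : ∀ m (t : Box n), tileOf L m = t → lab m = some t := fun m t h => by
    simp only [lab]
    rw [dif_pos (h ▸ t.2)]
    exact congrArg some (Subtype.ext h)
  have key := norm_sum_sq_le_two_mul (fun i : Option (Box n) => i.elim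
    (diffRow α E (restPart L n u) r) fun t => diffRow α E (tilePart L u t) r)
    (lab r) (lab (r + bandN M α)) ?_
  · simp only [Fintype.sum_option, Option.elim_none, Option.elim_some] at key
    rw [← diffRow_eq_rest_add_sum, mul_add] at key
    refine key.trans ?_
    rw [Finset.mul_sum]
    gcongr with t
    rw [rowWeight]
    linarith [one_le_of_not_isInterior (hint t)]
  · rintro (_ | t) h1 h2
    · refine diffRow_eq_zero α E fun k hk => if_pos ?_
      rcases tileOf_add_eq_or hL r hk with h | h <;> rw [h] <;> by_contra h'
      · exact h1 (show lab r = none from dif_neg h').symm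
      · exact h2 (show lab (r + bandN M α) = none from dif_neg h').symm
    · refine diffRow_eq_zero α E fun k hk => if_neg fun ht => ?_
      rcases tileOf_add_eq_or hL r hk with h | h <;> rw [h] at ht
      · exact h1 (hlab _ _ ht).symm
      · exact h2 (hlab _ _ ht).symm

/-- An interior row is reproduced exactly by its own tile and is invisible to the others. For all
other rows the weights are at most `0`. -/
theorem sum_rowWeight_mul_le (L n : ℕ) (u : ℤ → ℂ) (r : ℤ) :
    ∑ t : Box n, rowWeight (-1) L (bandN M α) (r - t * (2 * L + 1)) *
        ‖diffRow α E (tilePart L u t) r‖ ^ 2 ≤ ‖diffRow α E u r‖ ^ 2 := by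
  by_cases hint : ∃ t : Box n, IsInterior L (bandN M α) t r
  · obtain ⟨t, ht⟩ := hint
    rw [Finset.sum_eq_single t, ht.rowWeight, ht.diffRow_eq, one_mul]
    · intro s _ hs
      rw [ht.diffRow_eq_zero α E fun h => hs (Subtype.ext h)]
      simp
    · simp
  · rw [not_exists] at hint
    refine (Finset.sum_nonpos fun t _ => ?_).trans (sq_nonneg _)
    refine mul_nonpos_of_nonpos_of_nonneg ?_ (sq_nonneg _)
    rw [rowWeight]
    linarith [one_le_of_not_isInterior (hint t)]

theorem hasSum_rowWeight_tilePart (ε : ℝ) (L : ℕ) (u : ℤ → ℂ) (t : ℤ) :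
    HasSum (fun r => rowWeight ε L (bandN M α) (r - t * (2 * L + 1)) *
        ‖diffRow α E (tilePart L u t) r‖ ^ 2)
      (quadForm (withBC L (laurent (symbolG α E)) ((ε : ℂ) • bcD α E))
        fun j : Box L => u (t * (2 * L + 1) + j)) := by
  have h := (Equiv.subRight (t * (2 * L + 1))).hasSum_iff.2
    (quadForm_withBC α E ε L fun j : Box L => u (t * (2 * L + 1) + j))
  simpa only [Function.comp_def, Equiv.subRight_apply, diffRow_tilePart] using h

/-- The weight would be `-1` for a row straddling both endpoints at once, which `N ≤ 2L + 1` rules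
out. -/
theorem rowWeight_neg_one_nonneg {L N : ℕ} (hL : N ≤ 2 * L + 1) (r : ℤ) :
    0 ≤ rowWeight (-1) L N r := by
  rw [rowWeight]
  split_ifs
  · omega
  all_goals norm_num

theorem quadForm_neumann_nonneg {L : ℕ} (hL : bandN M α ≤ 2 * L + 1) (x : Box L → ℂ) :
    0 ≤ quadForm (neumann α E L) x := by
  rw [neumann_eq]
  exact (quadForm_withBC α E (-1) L x).nonneg fun r =>
    mul_nonneg (rowWeight_neg_one_nonneg hL r) (sq_nonneg _)

theorem quadForm_dirichlet_nonneg (L : ℕ) (x : Box L → ℂ) :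
    0 ≤ quadForm (dirichlet α E L) x := by
  rw [dirichlet_eq]
  exact (quadForm_withBC α E 1 L x).nonneg fun r =>
    mul_nonneg (rowWeight_one_nonneg _ _ r) (sq_nonneg _)

end Tiles

end LaurentIDS

end

noncomputable section

namespace LaurentIDS

/-! ### Operator bracketing on finitely many tiles -/

section Bracketing

open Matrix ContinuousLinearMap

open scoped InnerProductSpace

variable {H : Type*} [NormedAddCommGroup H] [InnerProductSpace ℂ H] [CompleteSpace H]

omit [CompleteSpace H] in
theorem hasSum_norm_inner_sq (b : HilbertBasis ℤ ℂ H) (φ : H) :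
    HasSum (fun r => ‖⟪b r, φ⟫_ℂ‖ ^ 2) (‖φ‖ ^ 2) := by
  have h := Complex.hasSum_re (b.hasSum_inner_mul_inner φ φ)
  rw [← inner_self_eq_norm_sq (𝕜 := ℂ)]
  convert h using 2 with r
  · rw [← inner_conj_symm φ, ← Complex.normSq_eq_conj_mul_self, Complex.normSq_eq_norm_sq,
      Complex.ofReal_re]
  · rfl

/-- The isometry that places a vector on the sites `σ i`. -/
def siteIsometry (b : HilbertBasis ℤ ℂ H) {ι : Type*} [Fintype ι] {σ : ι → ℤ}
    (hσ : Function.Injective σ) : EuclideanSpace ℂ ι →ₗᵢ[ℂ] H :=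
  LinearMap.isometryOfOrthonormal (v := (EuclideanSpace.basisFun ι ℂ).toBasis)
    ((EuclideanSpace.basisFun ι ℂ).toBasis.constr ℂ (b ∘ σ))
    (by simp)
    (by
      have : ⇑((EuclideanSpace.basisFun ι ℂ).toBasis.constr ℂ (b ∘ σ)) ∘
          ⇑(EuclideanSpace.basisFun ι ℂ).toBasis = b ∘ σ :=
        funext fun i => Module.Basis.constr_basis _ _ _ _
      rw [this]
      exact b.orthonormal.comp σ hσ)

variable (b : HilbertBasis ℤ ℂ H) {ι : Type*} [Fintype ι] {σ : ι → ℤ}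
  (hσ : Function.Injective σ)

omit [CompleteSpace H] in
theorem siteIsometry_apply (x : EuclideanSpace ℂ ι) :
    siteIsometry b hσ x = ∑ i, x i • b (σ i) := by
  change ((EuclideanSpace.basisFun ι ℂ).toBasis.constr ℂ (b ∘ σ)) x = _
  rw [Module.Basis.constr_apply_fintype]
  rfl

theorem adjoint_siteIsometry_apply (ψ : H) (i : ι) :
    adjoint (siteIsometry b hσ).toContinuousLinearMap ψ i = ⟪b (σ i), ψ⟫_ℂ := by
  classical
  have h := adjoint_inner_right (siteIsometry b hσ).toContinuousLinearMap
    (EuclideanSpace.single i (1 : ℂ)) ψ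
  rw [EuclideanSpace.inner_single_left, map_one, one_mul] at h
  rw [h]
  congr 1
  change siteIsometry b hσ _ = _
  rw [siteIsometry_apply, Finset.sum_eq_single i]
  · simp
  · intro j _ hj
    simp [hj]
  · simp

theorem inner_sub_siteIsometry (ψ : H) (n : ℤ) [Decidable (n ∈ Set.range σ)] :
    ⟪b n, ψ - siteIsometry b hσ (adjoint (siteIsometry b hσ).toContinuousLinearMap ψ)⟫_ℂ =
      if n ∈ Set.range σ then 0 else ⟪b n, ψ⟫_ℂ := by
  classical
  have hb : ∀ k, ⟪b n, b k⟫_ℂ = if n = k then (1 : ℂ) else 0 :=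
    orthonormal_iff_ite.1 b.orthonormal n
  rw [inner_sub_right, siteIsometry_apply, inner_sum]
  simp only [inner_smul_right, hb, adjoint_siteIsometry_apply]
  split_ifs with h
  · obtain ⟨i, rfl⟩ := h
    rw [Finset.sum_eq_single i]
    · simp
    · intro j _ hj
      rw [if_neg (fun h => hj (hσ h).symm), mul_zero]
    · simp
  · rw [Finset.sum_eq_zero, sub_zero]
    intro i _
    rw [if_neg (fun h' => h ⟨i, h'.symm⟩), mul_zero]

omit [CompleteSpace H] in
theorem re_inner_siteIsometry {T : H →L[ℂ] H} {X : Matrix ℤ ℤ ℂ} {c : ℝ}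
    (hT : ∀ n m, c * ⟪b n, T (b m)⟫_ℂ = X n m) (x : EuclideanSpace ℂ ι) :
    c * (⟪siteIsometry b hσ x, T (siteIsometry b hσ x)⟫_ℂ).re =
      quadForm (X.submatrix σ σ) x.ofLp := by
  rw [← Complex.re_ofReal_mul, quadForm, siteIsometry_apply, map_sum, sum_inner, Finset.mul_sum]
  simp only [inner_sum, map_smul, inner_smul_left, inner_smul_right, dotProduct, mulVec,
    submatrix_apply, ← hT, Finset.mul_sum]
  congr 1
  refine Finset.sum_congr rfl fun i _ => Finset.sum_congr rfl fun j _ => ?_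
  simp only [Pi.star_apply, Complex.star_def]
  ring

/-- The star homomorphism `X ↦ X ⊕ ⋯ ⊕ X`. -/
def blockHom (ι κ : Type*) [Fintype ι] [DecidableEq ι] [Fintype κ] [DecidableEq κ] :
    Matrix ι ι ℂ →⋆ₐ[ℂ] Matrix (ι × κ) (ι × κ) ℂ where
  toFun X := blockDiagonal fun _ => X
  map_one' := blockDiagonal_one
  map_mul' X Y := blockDiagonal_mul (fun _ => X) fun _ => Y
  map_zero' := blockDiagonal_zero
  map_add' X Y := blockDiagonal_add (fun _ => X) fun _ => Y
  commutes' z := by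
    rw [Algebra.algebraMap_eq_smul_one, Algebra.algebraMap_eq_smul_one, ← blockDiagonal_one,
      ← blockDiagonal_smul]
    rfl
  map_star' X := (blockDiagonal_conjTranspose fun _ => X).symm

theorem isHermitian_blockDiagonal {ι κ : Type*} [DecidableEq κ]
    {X : κ → Matrix ι ι ℂ} (hX : ∀ t, (X t).IsHermitian) : (blockDiagonal X).IsHermitian := by
  rw [IsHermitian, blockDiagonal_conjTranspose]
  exact congrArg _ (funext fun t => hX t)

theorem matPow_blockDiagonal {ι κ : Type*} [Fintype ι] [DecidableEq ι] [Fintype κ]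
    [DecidableEq κ] {X : Matrix ι ι ℂ} (hX : X.IsHermitian) {β : ℝ} (hβ : 0 ≤ β) :
    matPow (blockDiagonal fun _ : κ => X) β = blockDiagonal fun _ : κ => matPow X β :=
  (StarAlgHomClass.map_cfc (blockHom ι κ) (fun t : ℝ => t ^ β) X
    (Real.continuous_rpow_const hβ).continuousOn
    (LinearMap.continuous_of_finiteDimensional (blockHom ι κ).toAlgHom.toLinearMap) hX
    (isHermitian_blockDiagonal fun _ => hX)).symm

/-- The sites of the tiles `-n, …, n`. -/
abbrev TileIdx (L n : ℕ) : Type := Box L × Box n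

/-- The position of a site of a tile. -/
def tilePos (L n : ℕ) (i : TileIdx L n) : ℤ := i.2 * (2 * L + 1) + i.1

theorem tileOf_tilePos (L n : ℕ) (i : TileIdx L n) : tileOf L (tilePos L n i) = i.2 := by
  have := Finset.mem_Icc.1 i.1.2
  rw [tileOf_eq_iff, tilePos]
  constructor <;> linarith [this.1, this.2]

theorem tilePos_injective (L n : ℕ) : Function.Injective (tilePos L n) := by
  intro i j h
  have h2 : (i.2 : ℤ) = j.2 := by rw [← tileOf_tilePos, ← tileOf_tilePos, h]
  refine Prod.ext (Subtype.ext ?_) (Subtype.ext h2)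
  rw [tilePos, tilePos, h2] at h
  exact add_left_cancel h

theorem mem_range_tilePos (L n : ℕ) (m : ℤ) :
    m ∈ Set.range (tilePos L n) ↔ tileOf L m ∈ Finset.Icc (-(n : ℤ)) n := by
  constructor
  · rintro ⟨i, rfl⟩
    rw [tileOf_tilePos]
    exact i.2.2
  · intro h
    have h1 := (tileOf_eq_iff L m _).1 rfl
    exact ⟨(⟨m - tileOf L m * (2 * L + 1), Finset.mem_Icc.2 h1⟩, ⟨_, h⟩), by simp [tilePos]⟩

variable {M : ℕ} {α : ℝ} {E : Fin M → Real.Angle} {b} {A : H →L[ℂ] H}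

omit [CompleteSpace H] in
theorem inner_eq_diffRow (hA : ∀ n ψ, ⟪b n, A ψ⟫_ℂ = ∑ k ∈ Finset.range (bandN M α + 1),
      (factorPoly α E).coeff k * ⟪b (n + k), ψ⟫_ℂ) (ψ : H) (r : ℤ) :
    ⟪b r, A ψ⟫_ℂ = diffRow α E (fun n => ⟪b n, ψ⟫_ℂ) r := hA r ψ

theorem re_inner_star_mul_self (ψ : H) : (⟪ψ, (star A * A) ψ⟫_ℂ).re = ‖A ψ‖ ^ 2 := by
  rw [mul_apply_eq_comp, star_eq_adjoint, adjoint_inner_right]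
  exact inner_self_eq_norm_sq (𝕜 := ℂ) _

/-- Summing the row estimates leaves twice the squared norm of `A q`, where `q` is the part of `ψ`
off the tiles. The size of the constant `2 * ‖A‖ ^ 2` is irrelevant, since the term disappears under
compression. -/
theorem norm_sq_le_sum_dirichlet (hA : ∀ n ψ, ⟪b n, A ψ⟫_ℂ =
      ∑ k ∈ Finset.range (bandN M α + 1), (factorPoly α E).coeff k * ⟪b (n + k), ψ⟫_ℂ)
    {L : ℕ} (hL : bandN M α ≤ 2 * L + 1) (n : ℕ) (ψ : H) :
    ‖A ψ‖ ^ 2 ≤ quadForm (blockDiagonal fun _ : Box n => dirichlet α E L)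
        (adjoint (siteIsometry b (tilePos_injective L n)).toContinuousLinearMap ψ).ofLp +
      2 * ‖A‖ ^ 2 * ‖ψ - siteIsometry b (tilePos_injective L n)
        (adjoint (siteIsometry b (tilePos_injective L n)).toContinuousLinearMap ψ)‖ ^ 2 := by
  set q := ψ - siteIsometry b (tilePos_injective L n)
    (adjoint (siteIsometry b (tilePos_injective L n)).toContinuousLinearMap ψ) with hq
  let u : ℤ → ℂ := fun n => ⟪b n, ψ⟫_ℂ
  have hu : (fun m => ⟪b m, q⟫_ℂ) = restPart L n u := by
    classical
    funext m
    rw [hq, inner_sub_siteIsometry, restPart]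
    exact if_congr (mem_range_tilePos L n m) rfl rfl
  have h1 := hasSum_norm_inner_sq b (A ψ)
  have h2 := (hasSum_norm_inner_sq b (A q)).mul_left 2
  have h3 := hasSum_sum (s := Finset.univ) fun (t : Box n) _ =>
    hasSum_rowWeight_tilePart α E 1 L u t
  simp only [inner_eq_diffRow hA] at h1 h2
  rw [hu] at h2
  have h4 := hasSum_le (norm_diffRow_sq_le α E hL n u) h1 (h2.add h3)
  refine h4.trans ?_
  rw [quadForm_blockDiagonal, dirichlet_eq, add_comm]
  refine add_le_add (le_of_eq ?_) ?_
  · refine Finset.sum_congr rfl fun t _ => congrArg _ (funext fun j => ?_)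
    exact (adjoint_siteIsometry_apply b (tilePos_injective L n) ψ (j, t)).symm
  · have := A.le_opNorm q
    rw [mul_assoc, ← mul_pow]
    gcongr

theorem sum_neumann_le_norm_sq (hA : ∀ n ψ, ⟪b n, A ψ⟫_ℂ =
      ∑ k ∈ Finset.range (bandN M α + 1), (factorPoly α E).coeff k * ⟪b (n + k), ψ⟫_ℂ)
    (L n : ℕ) (ψ : H) :
    quadForm (blockDiagonal fun _ : Box n => neumann α E L)
      (adjoint (siteIsometry b (tilePos_injective L n)).toContinuousLinearMap ψ).ofLp ≤
      ‖A ψ‖ ^ 2 := by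
  let u : ℤ → ℂ := fun n => ⟪b n, ψ⟫_ℂ
  have h1 := hasSum_norm_inner_sq b (A ψ)
  have h3 := hasSum_sum (s := Finset.univ) fun (t : Box n) _ =>
    hasSum_rowWeight_tilePart α E (-1) L u t
  simp only [inner_eq_diffRow hA] at h1
  have h4 := hasSum_le (sum_rowWeight_mul_le α E L n u) h3 h1
  refine le_trans (le_of_eq ?_) h4
  rw [quadForm_blockDiagonal, neumann_eq]
  refine Finset.sum_congr rfl fun t _ => congrArg _ (funext fun j => ?_)
  exact adjoint_siteIsometry_apply b (tilePos_injective L n) ψ (j, t)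

theorem beta_mem_Icc {α : ℝ} (hα : 0 < α) : α / alphaBar α ∈ Set.Icc (0 : ℝ) 1 :=
  ⟨by positivity, div_le_one_of_le₀ (le_alphaBar α) (by positivity)⟩

variable (α E)

/-- Dirichlet bracketing for the restriction of `T_f` to finitely many tiles. -/
theorem quadForm_laurent_le (hα : 0 < α) {c : ℝ} (hc : 0 < c) {L : ℕ}
    (hL : bandN M α ≤ 2 * L + 1) (n : ℕ) (x : TileIdx L n → ℂ) :
    quadForm ((laurent (symbolF c α E)).submatrix (tilePos L n) (tilePos L n)) x ≤
      quadForm (blockDiagonal fun _ : Box n =>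
        (c : ℂ) • matPow (dirichlet α E L) (α / alphaBar α)) x := by
  obtain ⟨H, _, _, _, b, A, hA, -, hT⟩ := exists_laurent_model α E c hα
  have hβ := beta_mem_Icc hα
  have key := re_inner_cfc_rpow_le (siteIsometry b (tilePos_injective L n))
    (G := star A * A) (star_mul_self_nonneg A)
    (isHermitian_blockDiagonal fun _ : Box n => dirichlet_isHermitian α E L)
    (C := 2 * ‖A‖ ^ 2) (by positivity)
    (fun ψ => by rw [re_inner_star_mul_self]; exact norm_sq_le_sum_dirichlet hA hL n ψ)
    hβ (WithLp.toLp 2 x)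
  have h1 := re_inner_siteIsometry b (tilePos_injective L n) hT (WithLp.toLp 2 x)
  rw [← h1, show (fun _ : Box n => (c : ℂ) • matPow (dirichlet α E L) (α / alphaBar α)) =
    (c : ℂ) • fun _ : Box n => matPow (dirichlet α E L) (α / alphaBar α) from rfl,
    blockDiagonal_smul, quadForm_smul,
    ← matPow_blockDiagonal (dirichlet_isHermitian α E L) hβ.1]
  gcongr

/-- Neumann bracketing for the restriction of `T_f` to finitely many tiles. -/
theorem le_quadForm_laurent (hα : 0 < α) {c : ℝ} (hc : 0 < c) {L : ℕ}
    (hL : bandN M α ≤ 2 * L + 1) (n : ℕ) (x : TileIdx L n → ℂ) :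
    quadForm (blockDiagonal fun _ : Box n =>
        (c : ℂ) • matPow (neumann α E L) (α / alphaBar α)) x ≤
      quadForm ((laurent (symbolF c α E)).submatrix (tilePos L n) (tilePos L n)) x := by
  obtain ⟨H, _, _, _, b, A, hA, -, hT⟩ := exists_laurent_model α E c hα
  have hβ := beta_mem_Icc hα
  have key := le_re_inner_cfc_rpow (siteIsometry b (tilePos_injective L n))
    (G := star A * A) (star_mul_self_nonneg A)
    (isHermitian_blockDiagonal fun _ : Box n => neumann_isHermitian α E L)
    (fun y => by
      rw [quadForm_blockDiagonal]
      exact Finset.sum_nonneg fun t _ => quadForm_neumann_nonneg α E hL _)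
    (fun ψ => by rw [re_inner_star_mul_self]; exact sum_neumann_le_norm_sq hA L n ψ)
    hβ (WithLp.toLp 2 x)
  have h1 := re_inner_siteIsometry b (tilePos_injective L n) hT (WithLp.toLp 2 x)
  rw [← h1, show (fun _ : Box n => (c : ℂ) • matPow (neumann α E L) (α / alphaBar α)) =
    (c : ℂ) • fun _ : Box n => matPow (neumann α E L) (α / alphaBar α) from rfl,
    blockDiagonal_smul, quadForm_smul,
    ← matPow_blockDiagonal (neumann_isHermitian α E L) hβ.1]
  gcongr

/-- A uniform upper bound for the Dirichlet and Neumann forms. -/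
theorem exists_quadForm_withBC_le (hα : 0 < α) : ∃ C : ℝ, 0 ≤ C ∧ ∀ (L : ℕ) (x : Box L → ℂ),
    quadForm (dirichlet α E L) x ≤ C * normSq x ∧ quadForm (neumann α E L) x ≤ C * normSq x := by
  obtain ⟨H, _, _, _, b, A, hA, -, -⟩ := exists_laurent_model α E 1 hα
  -- A row weight is at most `1 + 2|ε| ≤ 3`, attained only if both ends are straddled. Independence
  -- of `L` allows one polynomial approximation for all boxes.
  refine ⟨3 * ‖A‖ ^ 2, by positivity, fun L x => ?_⟩
  let J := siteIsometry b (Subtype.val_injective : Function.Injective (Subtype.val : Box L → ℤ))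
  have hu : (fun m => ⟪b m, J (WithLp.toLp 2 x)⟫_ℂ) = boxExt x := by
    funext m
    have hb : ∀ k, ⟪b m, b k⟫_ℂ = if m = k then (1 : ℂ) else 0 :=
      orthonormal_iff_ite.1 b.orthonormal m
    simp only [J, siteIsometry_apply, inner_sum, inner_smul_right, hb, mul_ite, mul_one, mul_zero]
    rw [boxExt]
    split_ifs with h
    · rw [Finset.sum_eq_single ⟨m, h⟩]
      · simp
      · intro j _ hj
        exact if_neg fun h' => hj (Subtype.ext h'.symm)
      · simp
    · exact Finset.sum_eq_zero fun j _ => if_neg fun h' : m = j => h (h' ▸ j.2)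
  have h1 := hasSum_norm_inner_sq b (A (J (WithLp.toLp 2 x)))
  simp only [inner_eq_diffRow hA, hu, diffRow_boxExt] at h1
  have h2 : ‖A (J (WithLp.toLp 2 x))‖ ^ 2 ≤ ‖A‖ ^ 2 * normSq x := by
    have h3 := A.le_opNorm (J (WithLp.toLp 2 x))
    have h4 : normSq x = ‖J (WithLp.toLp 2 x)‖ ^ 2 := by
      rw [J.norm_map, EuclideanSpace.norm_sq_eq]
      rfl
    rw [h4, ← mul_pow]
    gcongr
  have h5 : ∀ ε : ℝ, |ε| ≤ 1 →
      quadForm (withBC L (laurent (symbolG α E)) ((ε : ℂ) • bcD α E)) x ≤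
        3 * ‖A‖ ^ 2 * normSq x := fun ε hε => by
    refine (hasSum_le (fun r => ?_) (quadForm_withBC α E ε L x) (h1.mul_left 3)).trans ?_
    · gcongr
      rw [rowWeight]
      have := abs_le.1 hε
      split_ifs <;> linarith
    · rw [mul_assoc]
      gcongr
  rw [dirichlet_eq, neumann_eq]
  exact ⟨h5 1 (by simp), h5 (-1) (by simp)⟩

end Bracketing

end LaurentIDS

end

noncomputable section

namespace LaurentIDS

/-! ### Counts on a large box against counts on its tiles -/

section DeterministicCount

open Matrix

variable {ι : Type*} [Fintype ι] [DecidableEq ι]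

omit [Fintype ι] in
theorem isHermitian_diagonal_ofReal (v : ι → ℝ) :
    (diagonal fun i => (v i : ℂ)).IsHermitian :=
  isHermitian_diagonal_of_self_adjoint _ (funext fun _ => Complex.conj_ofReal _)

theorem potential_isHermitian (L : ℕ) (ω : ℤ → ℝ) : (potential L ω).IsHermitian :=
  isHermitian_diagonal_ofReal fun n : Box L => ω n

theorem hamiltonian_isHermitian (f : ℝ → ℝ) (L : ℕ) (ω : ℤ → ℝ) :
    (hamiltonian f L ω).IsHermitian :=
  (restrict_laurent_isHermitian f L).add (potential_isHermitian L ω)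

theorem smul_matPow_isHermitian (c : ℝ) (A : Matrix ι ι ℂ) (β : ℝ) :
    ((c : ℂ) • matPow A β).IsHermitian := by
  have h : (matPow A β).IsHermitian := cfc_predicate (R := ℝ) (fun x : ℝ => x ^ β) A
  rw [IsHermitian, conjTranspose_smul, h.eq]
  simp

/-- The potential seen from the tile `t`. -/
def shiftPotential (L : ℕ) (t : ℤ) (ω : ℤ → ℝ) (j : ℤ) : ℝ := ω (t * (2 * L + 1) + j)

/-- The inclusion of the sites of the tiles `-n, …, n` into a box. -/
def tileEmb {L n K : ℕ} (h : n * (2 * L + 1) + L ≤ K) (i : TileIdx L n) : Box K :=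
  ⟨tilePos L n i, by
    have h1 := Finset.mem_Icc.1 i.1.2
    have h2 := Finset.mem_Icc.1 i.2.2
    have h3 : (n : ℤ) * (2 * L + 1) + L ≤ K := by exact_mod_cast h
    have h4 : (i.2 : ℤ) * (2 * L + 1) ≤ n * (2 * L + 1) :=
      mul_le_mul_of_nonneg_right h2.2 (by positivity)
    have h5 : (-(n : ℤ)) * (2 * L + 1) ≤ i.2 * (2 * L + 1) :=
      mul_le_mul_of_nonneg_right h2.1 (by positivity)
    rw [neg_mul] at h5
    rw [Finset.mem_Icc, tilePos]
    constructor <;> linarith [h1.1, h1.2]⟩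

theorem tileEmb_injective {L n K : ℕ} (h : n * (2 * L + 1) + L ≤ K) :
    Function.Injective (tileEmb h) := fun _ _ hij =>
  tilePos_injective L n (congrArg Subtype.val hij)

theorem hamiltonian_submatrix (f : ℝ → ℝ) {L n K : ℕ} (h : n * (2 * L + 1) + L ≤ K)
    (ω : ℤ → ℝ) : (hamiltonian f K ω).submatrix (tileEmb h) (tileEmb h) =
      (laurent f).submatrix (tilePos L n) (tilePos L n) +
        diagonal fun i => ((ω (tilePos L n i) : ℝ) : ℂ) := by
  have h1 : (potential K ω).submatrix (tileEmb h) (tileEmb h) =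
      diagonal fun i => ((ω (tilePos L n i) : ℝ) : ℂ) :=
    submatrix_diagonal (fun n : Box K => ((ω n : ℝ) : ℂ)) _ (tileEmb_injective h)
  rw [← h1]
  rfl

theorem blockDiagonal_add_potential {L n : ℕ} (X : Matrix (Box L) (Box L) ℂ) (ω : ℤ → ℝ) :
    (blockDiagonal fun t : Box n => X + potential L (shiftPotential L t ω)) =
      (blockDiagonal fun _ : Box n => X) +
        diagonal fun i : TileIdx L n => ((ω (tilePos L n i) : ℝ) : ℂ) := by
  rw [← blockDiagonal_diagonal fun (t : Box n) (j : Box L) => ((ω (tilePos L n (j, t)) : ℝ) : ℂ),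
    ← blockDiagonal_add]
  congr 1

theorem card_box (L : ℕ) : Fintype.card (Box L) = 2 * L + 1 := by
  rw [Fintype.card_coe, Int.card_Icc]
  omega

/-- Interlacing first discards the sites outside the tiles, which can only lower the count; on the
tiles the forms are compared, the potential being the same on both sides. -/
theorem sum_eigCount_le_hamiltonian (f : ℝ → ℝ) {L n K : ℕ} (h : n * (2 * L + 1) + L ≤ K)
    {X : Matrix (Box L) (Box L) ℂ} (hX : X.IsHermitian)
    (hle : ∀ x, quadForm ((laurent f).submatrix (tilePos L n) (tilePos L n)) x ≤
      quadForm (blockDiagonal fun _ : Box n => X) x) (ω : ℤ → ℝ) (e : ℝ) :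
    ∑ t : Box n, eigCount (X + potential L (shiftPotential L t ω)) e ≤
      eigCount (hamiltonian f K ω) e := by
  rw [← eigCount_blockDiagonal]
  refine le_trans ?_ (eigCount_submatrix_le (tileEmb_injective h) (hamiltonian_isHermitian f K ω) e)
  have := eigCount_le_of_quadForm_le
    (isHermitian_blockDiagonal fun t : Box n => hX.add (potential_isHermitian L
      (shiftPotential L t ω))) ((hamiltonian_isHermitian f K ω).submatrix (tileEmb h)) e 0
    (fun x => by
      rw [hamiltonian_submatrix, blockDiagonal_add_potential, quadForm_add, quadForm_add]
      linarith [hle x])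
  rwa [add_zero] at this

theorem hamiltonian_le_sum_eigCount (f : ℝ → ℝ) {L n K : ℕ} (h : n * (2 * L + 1) + L ≤ K)
    {X : Matrix (Box L) (Box L) ℂ} (hX : X.IsHermitian)
    (hle : ∀ x, quadForm (blockDiagonal fun _ : Box n => X) x ≤
      quadForm ((laurent f).submatrix (tilePos L n) (tilePos L n)) x) (ω : ℤ → ℝ) (e : ℝ) :
    eigCount (hamiltonian f K ω) e ≤
      ∑ t : Box n, eigCount (X + potential L (shiftPotential L t ω)) e +
        ((2 * K + 1) - (2 * L + 1) * (2 * n + 1)) := by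
  rw [← eigCount_blockDiagonal]
  have h1 := eigCount_le_submatrix_add (tileEmb_injective h) (hamiltonian_isHermitian f K ω) e
  rw [Fintype.card_prod, card_box, card_box, card_box] at h1
  refine h1.trans (Nat.add_le_add_right ?_ _)
  have := eigCount_le_of_quadForm_le ((hamiltonian_isHermitian f K ω).submatrix (tileEmb h))
    (isHermitian_blockDiagonal fun t : Box n => hX.add (potential_isHermitian L
      (shiftPotential L t ω))) e 0
    (fun x => by
      rw [hamiltonian_submatrix, blockDiagonal_add_potential, quadForm_add, quadForm_add]
      linarith [hle x])
  rwa [add_zero] at this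

/-- The spectrum is finite, so there is a gap directly above `e`. -/
theorem eventually_eigCount_add_le {A : Matrix ι ι ℂ} (hA : A.IsHermitian) (e : ℝ) :
    ∀ᶠ δ in 𝓝[>] (0 : ℝ), eigCount A (e + δ) ≤ eigCount A e := by
  classical
  have h : ∀ᶠ δ in 𝓝[>] (0 : ℝ), ∀ i, hA.eigenvalues i ≤ e + δ → hA.eigenvalues i ≤ e := by
    refine eventually_all.2 fun i => ?_
    by_cases hi : hA.eigenvalues i ≤ e
    · exact .of_forall fun _ _ => hi
    · have h1 : ∀ᶠ δ in 𝓝 (0 : ℝ), δ < hA.eigenvalues i - e :=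
        eventually_lt_nhds (sub_pos.2 (not_le.1 hi))
      filter_upwards [h1.filter_mono nhdsWithin_le_nhds] with δ hδ h2
      linarith
  filter_upwards [h] with δ hδ
  rw [eigCount_eq_card hA, eigCount_eq_card hA]
  exact Fintype.card_subtype_mono _ _ hδ

/-- Serves measurability in `ω`. Moving the potential by less than `δ` in the sup norm costs an
energy shift `δ`, which is absorbed by the gap above `e`. -/
theorem upperSemicontinuous_eigCount {X : Matrix ι ι ℂ} (hX : X.IsHermitian) (e : ℝ) :
    UpperSemicontinuous fun v : ι → ℝ => eigCount (X + diagonal fun i => (v i : ℂ)) e := by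
  intro v y hy
  have hv := hX.add (isHermitian_diagonal_ofReal v)
  obtain ⟨δ, h1, h2⟩ := ((eventually_eigCount_add_le hv e).and self_mem_nhdsWithin).exists
  filter_upwards [Metric.ball_mem_nhds v h2] with w hw
  refine lt_of_le_of_lt (le_trans ?_ h1) hy
  refine eigCount_le_of_quadForm_le (hX.add (isHermitian_diagonal_ofReal w)) hv e δ fun x => ?_
  rw [quadForm_add, quadForm_add, quadForm_diagonal, quadForm_diagonal, add_assoc, normSq,
    Finset.mul_sum, ← Finset.sum_add_distrib]
  gcongr with i
  rw [← add_mul]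
  gcongr
  have h3 := (dist_le_pi_dist w v i).trans_lt (Metric.mem_ball.1 hw)
  rw [Real.dist_eq] at h3
  linarith [(abs_lt.1 h3).1]

theorem measurable_eigCount {X : Matrix ι ι ℂ} (hX : X.IsHermitian) (e : ℝ) :
    Measurable fun v : ι → ℝ => (eigCount (X + diagonal fun i => (v i : ℂ)) e : ℝ) :=
  (measurable_from_nat (f := fun k : ℕ => (k : ℝ))).comp
    (upperSemicontinuous_eigCount hX e).measurable

end DeterministicCount

/-! ### The strong law over tiles -/

section LawOfLargeNumbers

open ProbabilityTheory

variable (P₀ : Measure ℝ) [IsProbabilityMeasure P₀]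

instance : IsProbabilityMeasure (law P₀) := by
  unfold law
  infer_instance

/-- The strong law of large numbers for functions of the potential in disjoint tiles, along an
injective sequence of tiles. -/
theorem strong_law_tiles (L : ℕ) {G : (Box L → ℝ) → ℝ} (hG : Measurable G) {C : ℝ}
    (hC : ∀ v, ‖G v‖ ≤ C) {τ : ℕ → ℤ} (hτ : Function.Injective τ) :
    ∀ᵐ ω ∂law P₀, Tendsto (fun n : ℕ =>
      (∑ i ∈ Finset.range n, G fun j => shiftPotential L (τ i) ω j) / n) atTop
      (𝓝 (∫ ω, G (fun j => ω j) ∂law P₀)) := by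
  have hinj : ∀ t : ℤ, Function.Injective fun j : Box L => t * (2 * L + 1) + (j : ℤ) :=
    fun t i j h => Subtype.ext (add_left_cancel h)
  have hm : ∀ t : ℤ, Measurable fun (ω : ℤ → ℝ) (j : Box L) => shiftPotential L t ω j :=
    fun t => measurable_pi_lambda _ fun j => measurable_pi_apply _
  have hmap : ∀ t : ℤ, (law P₀).map (fun (ω : ℤ → ℝ) (j : Box L) => shiftPotential L t ω j) =
      Measure.infinitePi fun _ : Box L => P₀ := fun t =>
    Measure.map_infinitePi_infinitePi_of_inj (P := fun _ : ℤ => P₀) (hinj t)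
  have hind : iIndepFun (fun (n : ℤ) (ω : ℤ → ℝ) => ω n) (law P₀) :=
    iIndepFun_infinitePi (P := fun _ : ℤ => P₀) (X := fun _ x => x) fun _ => measurable_id
  have hpair : ∀ t s : ℤ, t ≠ s →
      IndepFun (fun (ω : ℤ → ℝ) => G fun j : Box L => shiftPotential L t ω j)
        (fun (ω : ℤ → ℝ) => G fun j : Box L => shiftPotential L s ω j) (law P₀) := by
    intro t s hts
    let S : ℤ → Finset ℤ := fun t =>
      Finset.univ.image fun j : Box L => t * (2 * L + 1) + (j : ℤ)
    have hS : ∀ t, ∀ m ∈ S t, tileOf L m = t := by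
      intro t m hm
      obtain ⟨j, -, rfl⟩ := Finset.mem_image.1 hm
      have := Finset.mem_Icc.1 j.2
      rw [tileOf_eq_iff]
      constructor <;> linarith [this.1, this.2]
    have hdisj : Disjoint (S t) (S s) := Finset.disjoint_left.2 fun m h1 h2 =>
      hts ((hS t m h1).symm.trans (hS s m h2))
    have h1 := hind.indepFun_finset (S t) (S s) hdisj fun n => measurable_pi_apply n
    let φ : ∀ t, (S t → ℝ) → ℝ := fun t v =>
      G fun j => v ⟨t * (2 * L + 1) + j, Finset.mem_image_of_mem _ (Finset.mem_univ j)⟩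
    have hφ : ∀ t, Measurable (φ t) := fun t =>
      hG.comp (measurable_pi_lambda _ fun j => measurable_pi_apply _)
    exact h1.comp (hφ t) (hφ s)
  have hid : ∀ t s : ℤ, IdentDistrib (fun (ω : ℤ → ℝ) => G fun j : Box L => shiftPotential L t ω j)
      (fun (ω : ℤ → ℝ) => G fun j : Box L => shiftPotential L s ω j) (law P₀) (law P₀) := by
    intro t s
    have : IdentDistrib (fun (ω : ℤ → ℝ) (j : Box L) => shiftPotential L t ω j)
        (fun (ω : ℤ → ℝ) (j : Box L) => shiftPotential L s ω j) (law P₀) (law P₀) :=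
      ⟨(hm t).aemeasurable, (hm s).aemeasurable, by rw [hmap, hmap]⟩
    exact this.comp hG
  have hint : Integrable (fun (ω : ℤ → ℝ) => G fun j : Box L => shiftPotential L (τ 0) ω j)
      (law P₀) :=
    Integrable.of_bound (hG.comp (hm _)).aestronglyMeasurable C (.of_forall fun ω => hC _)
  -- Pairwise independence suffices here; it comes from the disjointness of the sets of sites of
  -- distinct tiles.
  have key := strong_law_ae_real
    (fun (i : ℕ) (ω : ℤ → ℝ) => G fun j : Box L => shiftPotential L (τ i) ω j) hint
    (fun i j hij => hpair _ _ (hτ.ne hij)) (fun i => hid _ _)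
  have h0 := (hid (τ 0) 0).integral_eq
  have h1 : (fun ω : ℤ → ℝ => G fun j : Box L => shiftPotential L 0 ω j) =
      fun ω => G fun j => ω j := by
    funext ω
    simp [shiftPotential]
  rw [h1] at h0
  rwa [h0] at key

theorem sum_box_eq (n : ℕ) (F : ℤ → ℝ) : ∑ t : Box n, F t =
    ∑ i ∈ Finset.range (n + 1), F i + ∑ i ∈ Finset.range n, F (-(i + 1 : ℕ)) := by
  rw [Finset.sum_coe_sort (Finset.Icc (-(n : ℤ)) n) F]
  induction n with
  | zero => simp
  | succ n ih =>
    have h : Finset.Icc (-((n + 1 : ℕ) : ℤ)) ((n + 1 : ℕ) : ℤ) =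
        insert ((n + 1 : ℕ) : ℤ) (insert (-((n + 1 : ℕ) : ℤ)) (Finset.Icc (-(n : ℤ)) n)) := by
      ext m
      simp only [Finset.mem_Icc, Finset.mem_insert]
      omega
    rw [h, Finset.sum_insert, Finset.sum_insert, ih, 
      Finset.sum_range_succ (fun i : ℕ => F i) (n + 1),
      Finset.sum_range_succ (fun i : ℕ => F (-(i + 1 : ℕ))) n]
    · ring
    · simp
    · simp only [Finset.mem_insert, Finset.mem_Icc]
      omega

/-- The one-sided law is applied to the tiles `0, 1, …` and to `-1, -2, …`; the two averages are
combined with weights `(n + 1) / (2n + 1)` and `n / (2n + 1)`. -/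
theorem strong_law_box (L : ℕ) {G : (Box L → ℝ) → ℝ} (hG : Measurable G) {C : ℝ}
    (hC : ∀ v, ‖G v‖ ≤ C) :
    ∀ᵐ ω ∂law P₀, Tendsto (fun n : ℕ =>
      (∑ t : Box n, G fun j => shiftPotential L t ω j) / (2 * n + 1)) atTop
      (𝓝 (∫ ω, G (fun j => ω j) ∂law P₀)) := by
  filter_upwards [strong_law_tiles P₀ L hG hC (τ := fun i => (i : ℤ)) Nat.cast_injective,
    strong_law_tiles P₀ L hG hC (τ := fun i => -((i + 1 : ℕ) : ℤ))
      (fun i j h => by simpa using h)] with ω h1 h2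
  set m := ∫ ω, G (fun j => ω j) ∂law P₀
  have h3 := (tendsto_add_atTop_iff_nat 1).2 h1
  have ht : Tendsto (fun n : ℕ => (n : ℝ) / (2 * n + 1)) atTop (𝓝 (1 / 2)) := by
    have : Tendsto (fun n : ℕ => (1 / 2 : ℝ) - (1 / 2) * (1 / (2 * n + 1))) atTop
        (𝓝 (1 / 2 - (1 / 2) * 0)) := by
      refine tendsto_const_nhds.sub (tendsto_const_nhds.mul ?_)
      refine tendsto_const_nhds.div_atTop ?_
      exact tendsto_atTop_add_const_right _ _
        (tendsto_natCast_atTop_atTop.const_mul_atTop (by norm_num))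
    rw [mul_zero, sub_zero] at this
    refine this.congr fun n => ?_
    field_simp
    ring
  have ht' : Tendsto (fun n : ℕ => 1 - (n : ℝ) / (2 * n + 1)) atTop (𝓝 (1 - 1 / 2)) :=
    tendsto_const_nhds.sub ht
  have h4 := (ht'.mul h3).add (ht.mul h2)
  rw [show (1 - 1 / 2) * m + 1 / 2 * m = m by ring] at h4
  refine h4.congr' ?_
  filter_upwards [eventually_gt_atTop 0] with n hn
  rw [sum_box_eq n fun t => G fun j : Box L => shiftPotential L t ω j]
  have : (n : ℝ) ≠ 0 := by positivity
  push_cast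
  field_simp
  ring

end LawOfLargeNumbers

end LaurentIDS

end

noncomputable section

/-! ### Almost sure bounds for the normalized counts -/

namespace LaurentIDS

open Matrix

/-- The largest `n` such that the tiles `-n, …, n` of length `2 L + 1` fit into `Λ_K`. -/
def tileCount (L K : ℕ) : ℕ := (K - L) / (2 * L + 1)

/-- The number of sites of `Λ_K` that are not covered by the tiles of length `2 L + 1`. -/
def leftover (L K : ℕ) : ℕ := (2 * K + 1) - (2 * L + 1) * (2 * tileCount L K + 1)

theorem tileCount_mul_le {L K : ℕ} (h : L ≤ K) : tileCount L K * (2 * L + 1) + L ≤ K := by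
  have := Nat.div_mul_le_self (K - L) (2 * L + 1)
  rw [tileCount]
  omega

/-- Less than one tile is left over at each end of `Λ_K`, a number of sites bounded independently of
`K`. -/
theorem leftover_spec {L K : ℕ} (h : L ≤ K) :
    (2 * L + 1) * (2 * tileCount L K + 1) + leftover L K = 2 * K + 1 ∧
      leftover L K ≤ 2 * (2 * L + 1) := by
  have h1 := Nat.div_add_mod (K - L) (2 * L + 1)
  have h2 := Nat.mod_lt (K - L) (show 0 < 2 * L + 1 by omega)
  have h3 : (2 * L + 1) * (2 * tileCount L K + 1) =
      2 * ((2 * L + 1) * ((K - L) / (2 * L + 1))) + (2 * L + 1) := by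
    rw [tileCount]
    ring
  rw [leftover, h3]
  omega

theorem tendsto_natCast_two_mul_add_one : Tendsto (fun K : ℕ => 2 * (K : ℝ) + 1) atTop atTop :=
  tendsto_atTop_add_const_right _ _
    (tendsto_natCast_atTop_atTop.const_mul_atTop (by norm_num))

theorem tendsto_leftover (L : ℕ) :
    Tendsto (fun K : ℕ => (leftover L K : ℝ) / (2 * K + 1)) atTop (𝓝 0) := by
  have h : Tendsto (fun K : ℕ => (2 * (2 * L + 1) : ℝ) / (2 * K + 1)) atTop (𝓝 0) :=
    tendsto_const_nhds.div_atTop tendsto_natCast_two_mul_add_one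
  refine squeeze_zero' (.of_forall fun K => by positivity) ?_ h
  filter_upwards [eventually_ge_atTop L] with K hK
  gcongr
  exact_mod_cast (leftover_spec hK).2

theorem tendsto_tileCount_ratio (L : ℕ) :
    Tendsto (fun K : ℕ => (2 * (tileCount L K : ℝ) + 1) / (2 * K + 1)) atTop
      (𝓝 (1 / (2 * L + 1))) := by
  have h := ((tendsto_const_nhds (x := (1 : ℝ))).sub (tendsto_leftover L)).div_const
    (2 * (L : ℝ) + 1)
  rw [sub_zero] at h
  refine h.congr' ?_
  filter_upwards [eventually_ge_atTop L] with K hK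
  have h1 : (2 * (L : ℝ) + 1) * (2 * tileCount L K + 1) + leftover L K = 2 * K + 1 := by
    exact_mod_cast (leftover_spec hK).1
  field_simp
  linarith

theorem tendsto_tileCount (L : ℕ) : Tendsto (tileCount L) atTop atTop :=
  (Nat.tendsto_div_const_atTop (by omega)).comp (tendsto_sub_atTop_nat L)

variable (P₀ : Measure ℝ) [IsProbabilityMeasure P₀]

theorem norm_eigCount_le {L : ℕ} {X : Matrix (Box L) (Box L) ℂ} (hX : X.IsHermitian) (e : ℝ)
    (v : Box L → ℝ) :
    ‖(eigCount (X + diagonal fun i => (v i : ℂ)) e : ℝ)‖ ≤ (2 * L + 1 : ℕ) := by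
  rw [Real.norm_natCast]
  exact_mod_cast (eigCount_le_card (hX.add (isHermitian_diagonal_ofReal v)) e).trans_eq (card_box L)

theorem integrable_eigCount {L : ℕ} {X : Matrix (Box L) (Box L) ℂ} (hX : X.IsHermitian) (e : ℝ) :
    Integrable (fun ω => (eigCount (X + potential L ω) e : ℝ)) (law P₀) :=
  Integrable.of_bound (((measurable_eigCount hX e).comp
    (measurable_pi_lambda _ fun j : Box L => measurable_pi_apply (j : ℤ))).aestronglyMeasurable)
    _ (.of_forall fun ω => norm_eigCount_le hX e fun j => ω j)

/-- The number of tiles per site tends to `1 / (2L + 1)`, which supplies the normalization in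
`expectedCount`. -/
theorem ae_tendsto_tile_average {L : ℕ} {X : Matrix (Box L) (Box L) ℂ} (hX : X.IsHermitian)
    (e : ℝ) : ∀ᵐ ω ∂law P₀, Tendsto (fun K : ℕ =>
      ((∑ t : Box (tileCount L K), eigCount (X + potential L (shiftPotential L t ω)) e : ℕ) : ℝ) /
        (2 * K + 1)) atTop (𝓝 (expectedCount P₀ L X e)) := by
  filter_upwards [strong_law_box P₀ L (measurable_eigCount hX e) (norm_eigCount_le hX e)]
    with ω hω
  have h := (hω.comp (tendsto_tileCount L)).mul (tendsto_tileCount_ratio L)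
  rw [mul_one_div] at h
  refine h.congr fun K => ?_
  have : 2 * (tileCount L K : ℝ) + 1 ≠ 0 := by positivity
  simp only [Function.comp_apply]
  rw [div_mul_div_cancel₀ this, Nat.cast_sum]
  rfl

theorem normalizedCount_mem_Icc (f : ℝ → ℝ) (K : ℕ) (ω : ℤ → ℝ) (e : ℝ) :
    normalizedCount f K ω e ∈ Set.Icc 0 1 := by
  refine ⟨by unfold normalizedCount; positivity, ?_⟩
  rw [normalizedCount, div_le_one (by positivity)]
  exact_mod_cast (eigCount_le_card (hamiltonian_isHermitian f K ω) e).trans_eq (card_box K)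

theorem normalizedCount_mono (f : ℝ → ℝ) (K : ℕ) (ω : ℤ → ℝ) :
    Monotone (normalizedCount f K ω) := fun e e' h => by
  unfold normalizedCount
  gcongr
  exact eigCount_mono (hamiltonian_isHermitian f K ω) h

theorem isBoundedUnder_le_normalizedCount (f : ℝ → ℝ) (ω : ℤ → ℝ) (e : ℝ) :
    IsBoundedUnder (· ≤ ·) atTop fun K : ℕ => normalizedCount f K ω e :=
  isBoundedUnder_of ⟨1, fun K => (normalizedCount_mem_Icc f K ω e).2⟩

theorem isBoundedUnder_ge_normalizedCount (f : ℝ → ℝ) (ω : ℤ → ℝ) (e : ℝ) :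
    IsBoundedUnder (· ≥ ·) atTop fun K : ℕ => normalizedCount f K ω e :=
  isBoundedUnder_of ⟨0, fun K => (normalizedCount_mem_Icc f K ω e).1⟩

/-- The exceptional null set depends on `e` and `X`, so only countably many energies can later be
treated simultaneously. -/
theorem ae_expectedCount_le_liminf (f : ℝ → ℝ) {L : ℕ} {X : Matrix (Box L) (Box L) ℂ}
    (hX : X.IsHermitian)
    (hle : ∀ n x, quadForm ((laurent f).submatrix (tilePos L n) (tilePos L n)) x ≤
      quadForm (blockDiagonal fun _ : Box n => X) x) (e : ℝ) :
    ∀ᵐ ω ∂law P₀, expectedCount P₀ L X e ≤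
      liminf (fun K : ℕ => normalizedCount f K ω e) atTop := by
  filter_upwards [ae_tendsto_tile_average P₀ hX e] with ω hω
  rw [← hω.liminf_eq]
  refine liminf_le_liminf ?_ hω.isBoundedUnder_ge
    (isBoundedUnder_le_normalizedCount f ω e).isCoboundedUnder_ge
  filter_upwards [eventually_ge_atTop L] with K hK
  unfold normalizedCount
  gcongr
  exact sum_eigCount_le_hamiltonian f (tileCount_mul_le hK) hX (hle _) ω e

theorem ae_limsup_le_expectedCount (f : ℝ → ℝ) {L : ℕ} {X : Matrix (Box L) (Box L) ℂ}
    (hX : X.IsHermitian)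
    (hle : ∀ n x, quadForm (blockDiagonal fun _ : Box n => X) x ≤
      quadForm ((laurent f).submatrix (tilePos L n) (tilePos L n)) x) (e : ℝ) :
    ∀ᵐ ω ∂law P₀, limsup (fun K : ℕ => normalizedCount f K ω e) atTop ≤
      expectedCount P₀ L X e := by
  filter_upwards [ae_tendsto_tile_average P₀ hX e] with ω hω
  have h := hω.add (tendsto_leftover L)
  rw [add_zero] at h
  rw [← h.limsup_eq]
  refine limsup_le_limsup ?_
    (isBoundedUnder_ge_normalizedCount f ω e).isCoboundedUnder_le h.isBoundedUnder_le
  filter_upwards [eventually_ge_atTop L] with K hK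
  rw [normalizedCount, ← add_div]
  gcongr
  exact_mod_cast hamiltonian_le_sum_eigCount f (tileCount_mul_le hK) hX (hle _) ω e

/-- The expected count is right-continuous in the energy. -/
theorem tendsto_expectedCount_right {L : ℕ} {X : Matrix (Box L) (Box L) ℂ} (hX : X.IsHermitian)
    {u : ℕ → ℝ} {e : ℝ} (hu : Tendsto u atTop (𝓝 e)) (hue : ∀ k, e < u k) :
    Tendsto (fun k => expectedCount P₀ L X (u k)) atTop (𝓝 (expectedCount P₀ L X e)) := by
  refine Tendsto.div_const ?_ _
  refine tendsto_integral_of_dominated_convergence (fun _ => ((2 * L + 1 : ℕ) : ℝ))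
    (fun k => (integrable_eigCount P₀ hX _).aestronglyMeasurable) (integrable_const _)
    (fun k => .of_forall fun ω => norm_eigCount_le hX (u k) fun j => ω j)
    (.of_forall fun ω => ?_)
  have hA := hX.add (potential_isHermitian L ω)
  have h1 : Tendsto (fun k => u k - e) atTop (𝓝[>] (0 : ℝ)) := by
    refine tendsto_nhdsWithin_iff.2 ⟨?_, .of_forall fun k => sub_pos.2 (hue k)⟩
    simpa using hu.sub_const e
  refine tendsto_const_nhds.congr' ?_
  filter_upwards [h1.eventually (eventually_eigCount_add_le hA e)] with k hk
  rw [add_sub_cancel] at hk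
  exact_mod_cast le_antisymm (eigCount_mono hA (hue k).le) hk

theorem expectedCount_mono {L : ℕ} {X : Matrix (Box L) (Box L) ℂ} (hX : X.IsHermitian) :
    Monotone (expectedCount P₀ L X) := fun e e' h => by
  unfold expectedCount
  gcongr
  · exact integrable_eigCount P₀ hX e
  · exact integrable_eigCount P₀ hX e'
  · intro ω
    exact Nat.cast_le.2 (eigCount_mono (hX.add (potential_isHermitian L ω)) h)

end LaurentIDS

end

noncomputable section

namespace LaurentIDS

/-! ### Fractional powers under finite rank perturbations -/

section PowerPerturbation

open Matrix

variable {ι κ : Type*} [Fintype ι] [DecidableEq ι] [Fintype κ]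

theorem quadForm_cfc {A : Matrix ι ι ℂ} (hA : A.IsHermitian) (f : ℝ → ℝ) (x : ι → ℂ) :
    quadForm (cfc f A) x = ∑ i, f (hA.eigenvalues i) *
      ‖((star (hA.eigenvectorUnitary : Matrix ι ι ℂ)) *ᵥ x) i‖ ^ 2 := by
  rw [← quadForm_diagonal, ← quadForm_conjTranspose_mul_mul, ← star_eq_conjTranspose, star_star,
    hA.cfc_eq, IsHermitian.cfc, Unitary.conjStarAlgAut_apply]
  rfl

theorem eigenvalues_mem_Icc {A : Matrix ι ι ℂ} (hA : A.IsHermitian) {a b : ℝ}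
    (h : ∀ x, a * normSq x ≤ quadForm A x ∧ quadForm A x ≤ b * normSq x) (i : ι) :
    hA.eigenvalues i ∈ Set.Icc a b := by
  let x : ι → ℂ := (hA.eigenvectorUnitary : Matrix ι ι ℂ) *ᵥ Pi.single i 1
  have hx : star (hA.eigenvectorUnitary : Matrix ι ι ℂ) *ᵥ x = Pi.single i 1 := by
    rw [mulVec_mulVec, Unitary.star_mul_self_of_mem (SetLike.coe_mem _), one_mulVec]
  have h1 : normSq x = 1 := by
    rw [← normSq_star_eigenvectorUnitary_mulVec hA, hx, normSq,
      Finset.sum_eq_single i (fun j _ hj => by simp [hj]) (by simp)]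
    simp
  have h2 : quadForm A x = hA.eigenvalues i := by
    rw [quadForm_eq_sum_eigenvalues hA, hx,
      Finset.sum_eq_single i (fun j _ hj => by simp [hj]) (by simp)]
    simp
  have := h x
  rw [h1, h2, mul_one, mul_one] at this
  exact this

theorem abs_quadForm_cfc_sub_le {A : Matrix ι ι ℂ} (hA : A.IsHermitian) {f g : ℝ → ℝ} {ε : ℝ}
    (h : ∀ i, |f (hA.eigenvalues i) - g (hA.eigenvalues i)| ≤ ε) (x : ι → ℂ) :
    |quadForm (cfc f A) x - quadForm (cfc g A) x| ≤ ε * normSq x := by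
  rw [quadForm_cfc hA, quadForm_cfc hA, ← Finset.sum_sub_distrib,
    ← normSq_star_eigenvectorUnitary_mulVec hA, normSq, Finset.mul_sum]
  refine (Finset.abs_sum_le_sum_abs _ _).trans (Finset.sum_le_sum fun i _ => ?_)
  rw [← sub_mul, abs_mul, abs_of_nonneg (sq_nonneg ‖_‖)]
  gcongr
  exact h i

/-- Two matrices whose difference annihilates the vectors `B ^ j x`, `j < d`, agree on `x` under
all polynomials of degree at most `d`. -/
theorem aeval_mulVec_eq {A B : Matrix ι ι ℂ} {d : ℕ} {x : ι → ℂ}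
    (h : ∀ j < d, (A - B) *ᵥ (B ^ j *ᵥ x) = 0) {q : Polynomial ℝ} (hq : q.natDegree ≤ d) :
    Polynomial.aeval A q *ᵥ x = Polynomial.aeval B q *ᵥ x := by
  have hp : ∀ j ≤ d, A ^ j *ᵥ x = B ^ j *ᵥ x := by
    intro j
    induction j with
    | zero => simp
    | succ j ih =>
      intro hj
      have h1 := h j (by omega)
      rw [sub_mulVec, sub_eq_zero] at h1
      rw [pow_succ', ← mulVec_mulVec, ih (by omega), h1, mulVec_mulVec, ← pow_succ']
  rw [Polynomial.aeval_eq_sum_range' (Nat.lt_succ_of_le hq),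
    Polynomial.aeval_eq_sum_range' (Nat.lt_succ_of_le hq), sum_mulVec, sum_mulVec]
  refine Finset.sum_congr rfl fun j hj => ?_
  rw [smul_mulVec, smul_mulVec, hp j (by simpa [Nat.lt_succ_iff] using hj)]

/-- If `A - B` has rank at most `#κ`, the eigenvalue counting functions of `c A ^ β + V` and
`c B ^ β + V` differ, up to a small shift of the energy, by a bounded multiple of `#κ`. -/
theorem exists_eigCount_smul_matPow_le (c C : ℝ) {β ε : ℝ} (hβ : 0 ≤ β) (hε : 0 < ε) :
    ∃ d : ℕ, ∀ {ι κ : Type} [Fintype ι] [DecidableEq ι] [Fintype κ] {A B V : Matrix ι ι ℂ},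
      A.IsHermitian → B.IsHermitian → V.IsHermitian →
      (∀ x, 0 ≤ quadForm A x ∧ quadForm A x ≤ C * normSq x) →
      (∀ x, 0 ≤ quadForm B x ∧ quadForm B x ≤ C * normSq x) →
      ∀ (Z : Matrix ι κ ℂ) (R : Matrix κ ι ℂ), A - B = Z * R → ∀ e : ℝ,
        eigCount ((c : ℂ) • matPow B β + V) e ≤
          eigCount ((c : ℂ) • matPow A β + V) (e + ε) + d * Fintype.card κ := by
  -- The difference of the powers need not have small rank, but that of polynomials does. The error
  -- `ε / 2` is spent once for `A` and once for `B`. As `q` depends only on `c`, `C`, `β` and `ε`,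
  -- its degree is uniform in the matrices.
  obtain ⟨q, hq⟩ := exists_polynomial_near_of_continuousOn 0 C (fun x => c * x ^ β)
    (continuous_const.mul (Real.continuous_rpow_const hβ)).continuousOn (ε / 2) (half_pos hε)
  refine ⟨q.natDegree, fun {ι κ} _ _ _ {A B V} hA hB hV hA' hB' Z R hZR e => ?_⟩
  have happrox : ∀ {X : Matrix ι ι ℂ}, X.IsHermitian →
      (∀ x, 0 ≤ quadForm X x ∧ quadForm X x ≤ C * normSq x) → ∀ x,
      |quadForm (Polynomial.aeval X q) x - quadForm ((c : ℂ) • matPow X β) x| ≤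
        ε / 2 * normSq x := by
    intro X hX hX' x
    have h1 : (c : ℂ) • matPow X β = cfc (fun x : ℝ => c * x ^ β) X := by
      rw [cfc_const_mul c (fun x : ℝ => x ^ β) X
        (Real.continuous_rpow_const hβ).continuousOn, matPow]
      ext i j
      simp
    rw [h1, ← cfc_polynomial q X hX]
    refine abs_quadForm_cfc_sub_le hX (fun i => (hq _ ?_).le) x
    exact eigenvalues_mem_Icc hX (fun x => by simpa using hX' x) i
  -- On the kernel of `D` the difference `A - B = Z * R` annihilates every `B ^ j x` with `j < deg
  -- q`, so `q(A) x = q(B) x`; the codimension is at most `deg q * #κ`.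
  let D : (ι → ℂ) →ₗ[ℂ] (Fin q.natDegree → κ → ℂ) :=
    LinearMap.pi fun j => (R * B ^ (j : ℕ)).mulVecLin
  have key := eigCount_le_eigCount_add_finrank
    ((smul_matPow_isHermitian c B β).add hV) ((smul_matPow_isHermitian c A β).add hV)
    LinearMap.id D (fun _ _ => rfl) e ε fun x hx => by
      have h1 : ∀ j < q.natDegree, (A - B) *ᵥ (B ^ j *ᵥ x) = 0 := by
        intro j hj
        have h2 : (R * B ^ j) *ᵥ x = 0 := congrFun hx ⟨j, hj⟩
        rw [hZR, mulVec_mulVec, Matrix.mul_assoc, ← mulVec_mulVec, h2, mulVec_zero]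
      have h2 : quadForm (Polynomial.aeval A q) x = quadForm (Polynomial.aeval B q) x := by
        rw [quadForm, quadForm, aeval_mulVec_eq h1 le_rfl]
      have h3 := abs_le.1 (happrox hA hA' x)
      have h4 := abs_le.1 (happrox hB hB' x)
      rw [LinearMap.id_apply, quadForm_add, quadForm_add]
      linarith [h3.1, h4.2]
  refine key.trans_eq ?_
  rw [Module.finrank_pi_fintype, Finset.sum_const, Module.finrank_fintype_fun_eq_card,
    Finset.card_univ, Fintype.card_fin, smul_eq_mul]

/-- The matrix of the inclusion of a family of sites. -/
def siteMatrix {N : ℕ} (L : ℕ) (σ : Fin N → ℤ) : Matrix (Fin N) (Box L) ℂ :=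
  Matrix.of fun i n => if (n : ℤ) = σ i then 1 else 0

theorem leftCorner_eq_mul (L : ℕ) {N : ℕ} (B : Matrix (Fin N) (Fin N) ℂ) :
    leftCorner L B = (siteMatrix L fun i : Fin N => -L + (i : ℕ)).transpose * B *
      siteMatrix L fun i : Fin N => -L + (i : ℕ) := by
  ext n m
  simp only [leftCorner, siteMatrix, mul_apply, of_apply, transpose_apply, Finset.sum_mul]
  rw [Finset.sum_comm]
  refine Finset.sum_congr rfl fun j _ => Finset.sum_congr rfl fun i _ => ?_
  rw [ite_and]
  split_ifs <;> simp

theorem rightCorner_eq_mul (L : ℕ) {N : ℕ} (B : Matrix (Fin N) (Fin N) ℂ) :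
    rightCorner L B = (siteMatrix L fun i : Fin N => L - (i.rev : ℕ)).transpose * B *
      siteMatrix L fun i : Fin N => L - (i.rev : ℕ) := by
  ext n m
  simp only [rightCorner, siteMatrix, mul_apply, of_apply, transpose_apply, Finset.sum_mul]
  rw [Finset.sum_comm]
  refine Finset.sum_congr rfl fun j _ => Finset.sum_congr rfl fun i _ => ?_
  rw [ite_and]
  split_ifs <;> simp

/-- The difference lives in the two corners and so factors through a space of dimension `2N`,
whatever `L` is. -/
theorem exists_withBC_sub_withBC_eq_mul (L : ℕ) (T : Matrix ℤ ℤ ℂ) {N : ℕ}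
    (B B' : Matrix (Fin N) (Fin N) ℂ) :
    ∃ (Z : Matrix (Box L) (Fin N ⊕ Fin N) ℂ) (R : Matrix (Fin N ⊕ Fin N) (Box L) ℂ),
      withBC L T B - withBC L T B' = Z * R := by
  let R₁ : Matrix (Fin N) (Box L) ℂ := siteMatrix L fun i => -L + (i : ℕ)
  let R₂ : Matrix (Fin N) (Box L) ℂ := siteMatrix L fun i => L - (i.rev : ℕ)
  refine ⟨fromCols (R₁ᵀ * (B - B')) (R₂ᵀ * (antiReflect B - antiReflect B')), fromRows R₁ R₂, ?_⟩
  rw [fromCols_mul_fromRows, withBC, withBC, leftCorner_eq_mul, leftCorner_eq_mul,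
    rightCorner_eq_mul, rightCorner_eq_mul, Matrix.mul_sub, Matrix.mul_sub, Matrix.sub_mul,
    Matrix.sub_mul]
  abel

end PowerPerturbation

variable {M : ℕ} (α : ℝ) (E : Fin M → Real.Angle) (P₀ : Measure ℝ) [IsProbabilityMeasure P₀]

/-- The constant depends neither on `L` nor on `e`, so the two bounds merge as `L → ∞`, up to the
shift `ε`. -/
theorem exists_expectedCount_neumann_le (hα : 0 < α) (c : ℝ) {ε : ℝ} (hε : 0 < ε) :
    ∃ C : ℝ, ∀ L : ℕ, bandN M α ≤ 2 * L + 1 → ∀ e : ℝ,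
      expectedCount P₀ L ((c : ℂ) • matPow (neumann α E L) (α / alphaBar α)) e ≤
        expectedCount P₀ L ((c : ℂ) • matPow (dirichlet α E L) (α / alphaBar α)) (e + ε) +
          C / (2 * L + 1) := by
  obtain ⟨C, -, hC⟩ := exists_quadForm_withBC_le α E hα
  obtain ⟨d, hd⟩ := exists_eigCount_smul_matPow_le c C (beta_mem_Icc hα).1 hε
  refine ⟨d * Fintype.card (Fin (bandN M α) ⊕ Fin (bandN M α)), fun L hL e => ?_⟩
  obtain ⟨Z, R, hZR⟩ := exists_withBC_sub_withBC_eq_mul L (laurent (symbolG α E))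
    (bcD α E) (bcN α E)
  have hDi := integrable_eigCount P₀ (smul_matPow_isHermitian c (dirichlet α E L)
    (α / alphaBar α)) (e + ε)
  have hNi := integrable_eigCount P₀ (smul_matPow_isHermitian c (neumann α E L)
    (α / alphaBar α)) e
  rw [expectedCount, expectedCount, ← add_div]
  gcongr
  have key := integral_mono hNi (hDi.add (integrable_const
    ((d * Fintype.card (Fin (bandN M α) ⊕ Fin (bandN M α)) : ℕ) : ℝ))) fun ω => by
      have := hd (dirichlet_isHermitian α E L) (neumann_isHermitian α E L)
        (potential_isHermitian L ω)
        (fun x => ⟨quadForm_dirichlet_nonneg α E L x, (hC L x).1⟩)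
        (fun x => ⟨quadForm_neumann_nonneg α E hL x, (hC L x).2⟩) Z R hZR e
      rw [Pi.add_apply, ← Nat.cast_add]
      exact Nat.cast_le.2 this
  refine key.trans_eq ?_
  rw [integral_add' hDi (integrable_const _), integral_const]
  simp

end LaurentIDS

end

noncomputable section

/-! ### Existence of the IDS and the bounds at every energy -/

namespace LaurentIDS

/-- Monotone functions whose lower and upper limits at rational points are sandwiched by a monotone
function `F` converge to its right limit at the continuity points of the latter. -/
theorem tendsto_of_rational_sandwich {F : ℝ → ℝ} (hF : Monotone F) {n : ℕ → ℝ → ℝ}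
    (hmono : ∀ K, Monotone (n K)) (h01 : ∀ K e, n K e ∈ Set.Icc 0 1)
    (hlow : ∀ q : ℚ, F q ≤ liminf (fun K => n K q) atTop)
    (hup : ∀ (q : ℚ) (e : ℝ), q < e → limsup (fun K => n K q) atTop ≤ F e)
    {e : ℝ} (he : ContinuousAt hF.stieltjesFunction e) :
    Tendsto (fun K => n K e) atTop (𝓝 (hF.stieltjesFunction e)) := by
  refine tendsto_order.2 ⟨fun y hy => ?_, fun y hy => ?_⟩
  · have h1 : ∀ᶠ x in 𝓝[<] e, y < hF.stieltjesFunction x :=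
      (he.tendsto.mono_left nhdsWithin_le_nhds).eventually (lt_mem_nhds hy)
    obtain ⟨x, hx, hxe⟩ := (h1.and self_mem_nhdsWithin).exists
    -- A rational strictly between `x` and `e` makes the right limit of `F` at `x` at most `F q`,
    -- where the lower bound is available.
    obtain ⟨q, hxq, hqe⟩ := exists_rat_btwn (show x < e from hxe)
    have h2 : y < liminf (fun K => n K q) atTop := by
      refine hx.trans_le (le_trans ?_ (hlow q))
      rw [hF.stieltjesFunction_eq]
      exact hF.rightLim_le hxq
    filter_upwards [eventually_lt_of_lt_liminf h2
      (isBoundedUnder_of ⟨0, fun K => (h01 K q).1⟩)] with K hK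
    exact hK.trans_le (hmono K hqe.le)
  · have h1 : ∀ᶠ x in 𝓝[>] e, hF.stieltjesFunction x < y :=
      (he.tendsto.mono_left nhdsWithin_le_nhds).eventually (gt_mem_nhds hy)
    obtain ⟨x, hx, hxe⟩ := (h1.and self_mem_nhdsWithin).exists
    obtain ⟨q, heq, hqx⟩ := exists_rat_btwn (show e < x from hxe)
    have h2 : limsup (fun K => n K q) atTop < y := by
      refine lt_of_le_of_lt ((hup q x hqx).trans ?_) hx
      rw [hF.stieltjesFunction_eq]
      exact hF.le_rightLim le_rfl
    filter_upwards [eventually_lt_of_limsup_lt h2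
      (isBoundedUnder_of ⟨1, fun K => (h01 K q).2⟩)] with K hK
    exact (hmono K heq.le).trans_lt hK

variable (P₀ : Measure ℝ) [IsProbabilityMeasure P₀]

/-- The candidate is the right-continuous version of the supremum `F` of the lower bounds `a L`. For
`q < x` the upper limit at `q` is at most `b L q ≤ a L x + C / (2L + 1) ≤ F x + C / (2L + 1)`, and
`L → ∞` leaves `F x`. Almost surely all `L ≥ m` and all rational energies can be used together. -/
theorem exists_isIDS {f : ℝ → ℝ} {a b : ℕ → ℝ → ℝ} {m : ℕ} (hmono : ∀ L, Monotone (a L))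
    (hab : ∀ ε > 0, ∃ C : ℝ, ∀ L, m ≤ L → ∀ e, b L e ≤ a L (e + ε) + C / (2 * L + 1))
    (h : ∀ L, m ≤ L → ∀ e, ∀ᵐ ω ∂law P₀,
      a L e ≤ liminf (fun K : ℕ => normalizedCount f K ω e) atTop ∧
        limsup (fun K : ℕ => normalizedCount f K ω e) atTop ≤ b L e) :
    ∃ Nf : ℝ → ℝ, IsIDS f P₀ Nf := by
  have hliminf : ∀ ω e, liminf (fun K : ℕ => normalizedCount f K ω e) atTop ≤ 1 := fun ω e =>
    (liminf_le_limsup (isBoundedUnder_le_normalizedCount f ω e)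
      (isBoundedUnder_ge_normalizedCount f ω e)).trans
      (limsup_le_of_le (isBoundedUnder_ge_normalizedCount f ω e).isCoboundedUnder_le
        (.of_forall fun K => (normalizedCount_mem_Icc f K ω e).2))
  -- A single realization in the full-measure set bounds the deterministic numbers `a L e` by `1`.
  have hbdd : ∀ e, BddAbove (Set.range fun L : Set.Ici m => a L e) := by
    refine fun e => ⟨1, ?_⟩
    rintro _ ⟨L, rfl⟩
    obtain ⟨ω, hω⟩ := (h L L.2 e).exists
    exact hω.1.trans (hliminf ω e)
  let F : ℝ → ℝ := fun e => ⨆ L : Set.Ici m, a L e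
  have hF : Monotone F := fun e e' hee' => ciSup_mono (hbdd e') fun L => hmono L hee'
  refine ⟨hF.stieltjesFunction, hF.stieltjesFunction.mono,
    hF.stieltjesFunction.right_continuous, ?_⟩
  have hall : ∀ᵐ ω ∂law P₀, ∀ (L : Set.Ici m) (q : ℚ),
      a L q ≤ liminf (fun K : ℕ => normalizedCount f K ω q) atTop ∧
        limsup (fun K : ℕ => normalizedCount f K ω q) atTop ≤ b L q :=
    ae_all_iff.2 fun L => ae_all_iff.2 fun q => h L L.2 q
  filter_upwards [hall] with ω hω e he
  refine tendsto_of_rational_sandwich hF (fun K => normalizedCount_mono f K ω)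
    (fun K e => normalizedCount_mem_Icc f K ω e) (fun q => ciSup_le fun L => (hω L q).1) ?_ he
  intro q x hqx
  obtain ⟨C, hC⟩ := hab (x - q) (sub_pos.2 hqx)
  have ht : Tendsto (fun L : ℕ => F x + C / (2 * L + 1)) atTop (𝓝 (F x + 0)) :=
    tendsto_const_nhds.add (tendsto_const_nhds.div_atTop tendsto_natCast_two_mul_add_one)
  rw [add_zero] at ht
  refine ge_of_tendsto ht ?_
  filter_upwards [eventually_ge_atTop m] with L hL
  have h1 := hC L hL q
  rw [add_sub_cancel] at h1
  have h2 : a L x ≤ F x := le_ciSup (hbdd x) (⟨L, hL⟩ : Set.Ici m)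
  linarith [(hω ⟨L, hL⟩ q).2]

/-- At a continuity point one good realization suffices, because all three quantities are
deterministic. A monotone function has only countably many discontinuities, so any `e` is a limit
from the right of continuity points, and all three functions are right-continuous. -/
theorem IsIDS.expectedCount_le_and_le {f Nf : ℝ → ℝ} (hN : IsIDS f P₀ Nf) {L : ℕ}
    {X Y : Matrix (Box L) (Box L) ℂ} (hX : X.IsHermitian) (hY : Y.IsHermitian)
    (h : ∀ e, ∀ᵐ ω ∂law P₀,
      expectedCount P₀ L X e ≤ liminf (fun K : ℕ => normalizedCount f K ω e) atTop ∧
        limsup (fun K : ℕ => normalizedCount f K ω e) atTop ≤ expectedCount P₀ L Y e) (e : ℝ) :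
    expectedCount P₀ L X e ≤ Nf e ∧ Nf e ≤ expectedCount P₀ L Y e := by
  have hcont : ∀ x, ContinuousAt Nf x →
      expectedCount P₀ L X x ≤ Nf x ∧ Nf x ≤ expectedCount P₀ L Y x := by
    intro x hx
    obtain ⟨ω, h1, h2⟩ := ((h x).and hN.lim).exists
    rwa [(h2 x hx).liminf_eq, (h2 x hx).limsup_eq] at h1
  obtain ⟨u, -, hu, hue⟩ :=
    (hN.mono.countable_not_continuousAt.dense_compl ℝ).exists_seq_strictAnti_tendsto e
  have hu' : ∀ k, expectedCount P₀ L X (u k) ≤ Nf (u k) ∧ Nf (u k) ≤ expectedCount P₀ L Y (u k) :=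
    fun k => hcont _ (not_not.1 (hu k).2)
  have hNu : Tendsto (fun k => Nf (u k)) atTop (𝓝 (Nf e)) :=
    (hN.rightCts e).tendsto.comp (tendsto_nhdsWithin_iff.2
      ⟨hue, .of_forall fun k => (Set.mem_Ioi.1 (hu k).1).le⟩)
  exact ⟨le_of_tendsto_of_tendsto' (tendsto_expectedCount_right P₀ hX hue fun k => (hu k).1) hNu
      fun k => (hu' k).1,
    le_of_tendsto_of_tendsto' hNu (tendsto_expectedCount_right P₀ hY hue fun k => (hu k).1)
      fun k => (hu' k).2⟩

variable {M : ℕ} (α : ℝ) (E : Fin M → Real.Angle)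

theorem ae_expectedCount_dirichlet_neumann (hα : 0 < α) {c : ℝ} (hc : 0 < c) {L : ℕ}
    (hL : bandN M α ≤ 2 * L + 1) (e : ℝ) :
    ∀ᵐ ω ∂law P₀,
      expectedCount P₀ L ((c : ℂ) • matPow (dirichlet α E L) (α / alphaBar α)) e ≤
        liminf (fun K : ℕ => normalizedCount (symbolF c α E) K ω e) atTop ∧
      limsup (fun K : ℕ => normalizedCount (symbolF c α E) K ω e) atTop ≤
        expectedCount P₀ L ((c : ℂ) • matPow (neumann α E L) (α / alphaBar α)) e :=
  (ae_expectedCount_le_liminf P₀ (symbolF c α E) (smul_matPow_isHermitian c _ _)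
    (quadForm_laurent_le α E hα hc hL) e).and
  (ae_limsup_le_expectedCount P₀ (symbolF c α E) (smul_matPow_isHermitian c _ _)
    (le_quadForm_laurent α E hα hc hL) e)

end LaurentIDS

end

theorem corollary3p3 {M : ℕ} (E : Fin M → Real.Angle) (hE : Function.Injective E)
    (α c : ℝ) (hα : 0 < α) (hc : 0 < c)
    (P₀ : MeasureTheory.Measure ℝ) [MeasureTheory.IsProbabilityMeasure P₀]
    (hnt : ∀ v : ℝ, P₀ ≠ MeasureTheory.Measure.dirac v) (hP₀ : IsGLB P₀.support 0) :
    -- the integrated density of states exists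
    (∃ Nf : ℝ → ℝ, LaurentIDS.IsIDS (LaurentIDS.symbolF c α E) P₀ Nf) ∧
    -- and satisfies the two bounds
    (∀ Nf : ℝ → ℝ, LaurentIDS.IsIDS (LaurentIDS.symbolF c α E) P₀ Nf →
      ∀ L : ℕ, 2 * LaurentIDS.bandN M α + 1 ≤ L → ∀ e : ℝ,
        LaurentIDS.expectedCount P₀ L
            ((c : ℂ) • LaurentIDS.matPow (LaurentIDS.dirichlet α E L)
              (α / LaurentIDS.alphaBar α)) e ≤ Nf e ∧
        Nf e ≤ LaurentIDS.expectedCount P₀ L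
            ((c : ℂ) • LaurentIDS.matPow (LaurentIDS.neumann α E L)
              (α / LaurentIDS.alphaBar α)) e) ∧
    -- the bounds also hold at every energy for all limit points of the normalized counts
    (∀ L : ℕ, 2 * LaurentIDS.bandN M α + 1 ≤ L → ∀ e : ℝ,
      ∀ᵐ ω ∂LaurentIDS.law P₀,
        LaurentIDS.expectedCount P₀ L
            ((c : ℂ) • LaurentIDS.matPow (LaurentIDS.dirichlet α E L)
              (α / LaurentIDS.alphaBar α)) e ≤
          Filter.liminf (fun K : ℕ =>
            LaurentIDS.normalizedCount (LaurentIDS.symbolF c α E) K ω e) Filter.atTop ∧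
        Filter.limsup (fun K : ℕ =>
            LaurentIDS.normalizedCount (LaurentIDS.symbolF c α E) K ω e) Filter.atTop ≤
          LaurentIDS.expectedCount P₀ L
            ((c : ℂ) • LaurentIDS.matPow (LaurentIDS.neumann α E L)
              (α / LaurentIDS.alphaBar α)) e) := by
  -- This is the form of the size condition under which no stencil straddles both ends of a tile.
  have hL' : ∀ L : ℕ, 2 * LaurentIDS.bandN M α + 1 ≤ L → LaurentIDS.bandN M α ≤ 2 * L + 1 :=
    fun L hL => by omega
  have hX : ∀ (A : (L : ℕ) → Matrix (LaurentIDS.Box L) (LaurentIDS.Box L) ℂ) (L : ℕ),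
      ((c : ℂ) • LaurentIDS.matPow (A L) (α / LaurentIDS.alphaBar α)).IsHermitian :=
    fun A L => LaurentIDS.smul_matPow_isHermitian c (A L) _
  have key := fun (L : ℕ) (hL : 2 * LaurentIDS.bandN M α + 1 ≤ L) (e : ℝ) =>
    LaurentIDS.ae_expectedCount_dirichlet_neumann P₀ α E hα hc (hL' L hL) e
  refine ⟨LaurentIDS.exists_isIDS P₀ (fun L => LaurentIDS.expectedCount_mono P₀
    (hX (LaurentIDS.dirichlet α E) L)) (fun ε hε => ?_) key, ?_, key⟩
  · obtain ⟨C, hC⟩ := LaurentIDS.exists_expectedCount_neumann_le α E P₀ hα c hε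
    exact ⟨C, fun L hL => hC L (hL' L hL)⟩
  · exact fun Nf hN L hL e => hN.expectedCount_le_and_le P₀ (hX (LaurentIDS.dirichlet α E) L)
      (hX (LaurentIDS.neumann α E) L) (key L hL) e
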